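/- **Setting.** Let $d\ge 1$, $\delta\in(0,1)$, $p=\frac{1-\delta}{2}$, and $\Lambda_n=[-n,n]^d\cap\mathbb Z^d$. Let $(\theta_u)_{u\in\mathbb Z^d}$ be i.i.d. uniform signs in $\{-1,+1\}$. For every unordered pair $\{u,v\}\subset\Lambda_n$ with $|u-v|_2=1$ one observes $Y^\delta_{uv}$, which equals $\theta_u\theta_v$ with probability $1-p$ and $-\theta_u\theta_v$ with probability $p$, independently over edges given $\theta$. For $\eta\ge 0$ and an integer $L\ge 1$, one also observes the side information $$Y^{\eta,L}_{uv}=\sqrt{\eta/L^d}\;\theta_u\theta_v+Z_{uv}$$ for every unordered pair $(u,v)$ in $\Lambda_n$ with $|u-v|_\infty\le L$, where the $Z_{uv}$ are i.i.d. $N(0,1)$, independent of everything else. Write $Y^{\delta,\eta,L}_{\Lambda_n}$ for the collection of all these observations. An estimator is a family $T=(T_{uv})_{u,v\in\Lambda_n}$ of measurable $\{-1,+1\}$-valued functions of the observations, and $$\mathcal R_{\Lambda_n}(T)=\frac1{|\Lambda_n|^2}\sum_{u,v\in\Lambda_n}\mathbb E\big[T_{uv}(Y^{\delta,\eta,L}_{\Lambda_n})\,\theta_u\theta_v\big].$$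 **Threshold.** For $\delta\in[0,1]$ and $\eta>0$ let $$\varphi_n(\delta,\eta)=\frac1{|\Lambda_n|^2}\sum_{u,v\in\Lambda_n}\mathbb E\Big[\mathbb E\big[\theta_u\theta_v\,\big|\,Y^{\delta,\eta,2n+1}_{\Lambda_n}\big]^2\Big].$$ For each $\delta$ this sequence converges as $n\to\infty$ for all but countably many $\eta$; where it converges, let $q_\star(\delta,\eta)\ge 0$ be the square root of the limit. Let $q_{\star\star}(\delta)$ be the limit of $q_\star(\delta,\eta)$ as $\eta\to0^+$ along the $\eta$ at which $\varphi_n(\delta,\eta)$ converges, and let $\delta_c=\inf\{\delta\in(0,1]: q_{\star\star}(\delta)>0\}$. **Theorem.** Let $0<\delta<1$ with $\delta<\delta_c$, and let $(L_n)_{n\ge 0}$ be any sequence of integers with $L_n\ge 1$. There is a set $\mathcal A\subset\mathbb R_+=[0,\infty)$ of full Lebesgue measure in $\mathbb R_+$ (depending only on $d$, $\delta$ and $(L_n)$) such that the following holds. For every choice of estimators $T^{(n)}=(T^{(n)}_{uv})_{u,v\in\Lambda_n}$ with $T^{(n)}_{uv}=T^{(n)}_{uv}(Y^{\delta,\eta,L_n}_{\Lambda_n})\in\{-1,+1\}$,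 which may also depend on $\eta$, $$\lim_{\substack{\eta\to0^+\\ \eta\in\mathcal A}}\ \liminf_{n\to\infty}\ \big|\mathcal R_{\Lambda_n}(T^{(n)})\big|=0.$$ -/

import Mathlib

open MeasureTheory ProbabilityTheory Filter Topology

noncomputable section

/-- The box `Λ_n = [-n, n]^d ∩ ℤ^d`. -/
abbrev Box (d n : ℕ) : Type :=
  {u : Fin d → ℤ // ∀ i, |u i| ≤ (n : ℤ)}

/-- The box has finitely many vertices. -/
instance Box.instFinite (d n : ℕ) : Finite (Box d n) := by
  have h : {u : Fin d → ℤ | ∀ i, |u i| ≤ (n : ℤ)}.Finite := by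
    refine (Set.finite_Icc (fun _ : Fin d => -(n : ℤ)) (fun _ => (n : ℤ))).subset ?_
    intro u hu
    exact ⟨fun i => (abs_le.mp (hu i)).1, fun i => (abs_le.mp (hu i)).2⟩
  exact h.to_subtype

instance Box.instFintype (d n : ℕ) : Fintype (Box d n) := Fintype.ofFinite _

/-- Nearest neighbours in the box: Euclidean distance equal to `1`. -/
def Box.Adj {d n : ℕ} (u v : Box d n) : Prop :=
  ∑ i, (u.1 i - v.1 i) ^ 2 = 1

/-- Being at `ℓ^∞` distance at most `L`. -/
def Box.Near {d n : ℕ} (L : ℕ) (u v : Box d n) : Prop :=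
  ∀ i, |u.1 i - v.1 i| ≤ (L : ℤ)

theorem Box.adj_symm {d n : ℕ} : Std.Symm (Box.Adj (d := d) (n := n)) := by
  refine ⟨fun u v h => ?_⟩
  unfold Box.Adj at h ⊢
  rw [← h]
  exact Finset.sum_congr rfl fun i _ => by ring

theorem Box.near_symm {d n : ℕ} (L : ℕ) : Std.Symm (Box.Near (d := d) (n := n) L) := by
  refine ⟨fun u v h i => ?_⟩
  rw [abs_sub_comm]
  exact h i

/-- The edge set `E_n` of the box: unordered pairs of nearest neighbours. -/
abbrev Edge (d n : ℕ) : Type :=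
  {e : Sym2 (Box d n) // e ∈ Sym2.fromRel (Box.adj_symm (d := d) (n := n))}

/-- Unordered pairs of vertices of the box (diagonal included) at `ℓ^∞` distance at most `L`. -/
abbrev RangePair (d n L : ℕ) : Type :=
  {e : Sym2 (Box d n) // e ∈ Sym2.fromRel (Box.near_symm (d := d) (n := n) L)}

instance Edge.instFintype (d n : ℕ) : Fintype (Edge d n) := Fintype.ofFinite _

instance RangePair.instFintype (d n L : ℕ) : Fintype (RangePair d n L) := Fintype.ofFinite _

/-- Every set of signs is measurable. -/
instance instMeasurableSingletonClassSigns : MeasurableSingletonClass ℤˣ where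
  measurableSet_singleton s :=
    ⟨{(s : ℤ)}, MeasurableSet.singleton _, by ext t; simp [Units.ext_iff]⟩

/-- A sign, i.e. an element of `{-1, +1}`, as a real number. -/
def signVal (s : ℤˣ) : ℝ := ((s : ℤ) : ℝ)

/-- The law on `{-1, +1}` with mean `m ∈ [-1, 1]`. -/
def signLaw (m : ℝ) : Measure ℤˣ :=
  ENNReal.ofReal ((1 + m) / 2) • Measure.dirac 1 + ENNReal.ofReal ((1 - m) / 2) • Measure.dirac (-1)

/-- The sources of randomness: the spins `θ`, the signs of the lattice noise (one per edge) and the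
noise of the side information (one real number per unordered pair in range). -/
abbrev Sample (d n L : ℕ) : Type :=
  (Box d n → ℤˣ) × (Edge d n → ℤˣ) × (RangePair d n L → ℝ)

/-- The values that the observations can take. -/
abbrev Obs (d n L : ℕ) : Type :=
  (Edge d n → ℤˣ) × (RangePair d n L → ℝ)

/-- All coordinates are independent: the spins are uniform signs, a lattice noise sign is `-1` with
probability `p = (1 - δ) / 2`, and the noise of the side information is standard Gaussian. -/
def sampleLaw (d n L : ℕ) (δ : ℝ) : Measure (Sample d n L) :=
  (Measure.pi fun _ => signLaw 0).prod
    ((Measure.pi fun _ => signLaw δ).prod (Measure.pi fun _ => gaussianReal 0 1))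

/-- `θ_u θ_v` for the unordered pair `{u, v}`. -/
def pairSpin {d n : ℕ} (θ : Box d n → ℤˣ) : Sym2 (Box d n) → ℤˣ :=
  Sym2.lift ⟨fun u v => θ u * θ v, fun u v => mul_comm (θ u) (θ v)⟩

/-- The observations: `± θ_u θ_v` on the edges, together with the spiked Gaussian side information
`√(η / L^d) θ_u θ_v + Z_{uv}` on the pairs in range. -/
def observe (d n L : ℕ) (η : ℝ) (ω : Sample d n L) : Obs d n L :=
  (fun e => ω.2.1 e * pairSpin ω.1 e.1,
   fun e => Real.sqrt (η / (L : ℝ) ^ d) * signVal (pairSpin ω.1 e.1) + ω.2.2 e)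

/-- The average correlation `R_{Λ_n}(T)` of an estimator `T = (T_{uv})` with `θ_u θ_v`. -/
def risk (d n L : ℕ) (δ η : ℝ) (T : Box d n → Box d n → Obs d n L → ℤˣ) : ℝ :=
  1 / (Fintype.card (Box d n) : ℝ) ^ 2 *
    ∑ u, ∑ v, ∫ ω, signVal (T u v (observe d n L η ω)) * signVal (ω.1 u) * signVal (ω.1 v)
      ∂(sampleLaw d n L δ)

/-- The average pair correlation
`|Λ_n|⁻² ∑_{u,v} E[ E[θ_u θ_v | Y]² ]`, with side information of range `L = 2n + 1`, that is, for
all pairs of vertices of the box. -/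
def pairCorr (d n : ℕ) (δ η : ℝ) : ℝ :=
  1 / (Fintype.card (Box d n) : ℝ) ^ 2 *
    ∑ u, ∑ v, ∫ ω,
      (((sampleLaw d n (2 * n + 1) δ)[fun ω' => signVal (ω'.1 u) * signVal (ω'.1 v) |
        MeasurableSpace.comap (observe d n (2 * n + 1) η) inferInstance]) ω) ^ 2
      ∂(sampleLaw d n (2 * n + 1) δ)

/-- The positive values of `η` at which the average pair correlation converges as `n → ∞`. -/
def convSet (d : ℕ) (δ : ℝ) : Set ℝ :=
  {η | 0 < η ∧ ∃ l : ℝ, Tendsto (fun n => pairCorr d n δ η) atTop (𝓝 l)}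

/-- `q_⋆(δ, η) ≥ 0`, whose square is the limit of the average pair correlation; only used for
`η ∈ convSet d δ`, where this limit exists. -/
def qStar (d : ℕ) (δ η : ℝ) : ℝ :=
  Real.sqrt (limUnder atTop fun n => pairCorr d n δ η)

/-- `q` is the limit `q_⋆⋆(δ)` of `q_⋆(δ, η)` as `η → 0⁺` within the `η` at which `q_⋆(δ, η)` is
defined. -/
def IsQStarStar (d : ℕ) (δ q : ℝ) : Prop :=
  Tendsto (qStar d δ) (𝓝[convSet d δ] 0) (𝓝 q)

/-- The synchronization threshold `δ_c = inf {δ > 0 : q_⋆⋆(δ) > 0}`, where `δ` ranges over the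
parameter interval `[0, 1]`. -/
def deltaC (d : ℕ) : ℝ :=
  sInf {δ | 0 < δ ∧ δ ≤ 1 ∧ ∃ q, IsQStarStar d δ q ∧ 0 < q}

end

/-! Write `N` for the number of vertices. Side information of range `L` consists of `O(N L^d)`
Gaussian channels of signal-to-noise ratio `η / L^d`. Hence it raises the entropy `ent` of the data
by at most `O(N η)`, whatever `L` is. Full-range side information of fixed strength `l` serves as a
probe: it has about `N²` channels of ratio `l / N`, and opening them raises the entropy by about `l
N` times the average squared pair correlation, up to constant factors and an `O(l²)` error.

Opening the two families in either order leads to the same total entropy (`sum_ovl_le`). So the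
average squared correlation given the short-range data is at most `O(η / l)`, plus a constant times
`pairCorr` at strength `l`, plus `O(l / N)` (`meanOvl_le`). Below the threshold, `l` can be fixed
with a small limiting `pairCorr` (`exists_qStar_lt`); then `n → ∞`, and finally `η → 0`. The
correlation achieved by any estimator is controlled by the same second moment (`abs_risk_le`).

The entropy estimates need no derivative in the signal-to-noise ratio. Opening one channel from `0`
to `t` is bounded below and above by explicit multiples of the overlap `ovl` (`le_ent_update`,
`ent_update_le`), and `ovl` increases with information (`ovl_mono`). The edge observations are
frozen and absorbed into prior weights of total mass below one; they are summed over only at the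
end. -/

noncomputable section

/-! ### Gaussian channels with sign inputs: likelihood ratios, mixing, degradation. -/

/-- The standard Gaussian measure on `ℝ^K`. -/
abbrev gaussPi (K : Type*) [Fintype K] : Measure (K → ℝ) :=
  Measure.pi fun _ : K => gaussianReal 0 1

/-- The likelihood ratio of `√s a + N(0,1)` with respect to `N(0,1)`, for a sign `a`. -/
def kern (s a y : ℝ) : ℝ := Real.exp (Real.sqrt s * a * y - s / 2)

theorem kern_pos (s a y : ℝ) : 0 < kern s a y := Real.exp_pos _

theorem kern_zero (a y : ℝ) : kern 0 a y = 1 := by simp [kern]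

@[fun_prop]
theorem measurable_kern (s a : ℝ) : Measurable (kern s a) := by unfold kern; fun_prop

theorem kern_eq_mul (s a : ℝ) :
    kern s a = fun y => Real.exp (-(s / 2)) * Real.exp (Real.sqrt s * a * y) := by
  funext y; rw [kern, ← Real.exp_add]; ring_nf

theorem integrable_kern (s a : ℝ) : Integrable (kern s a) (gaussianReal 0 1) := by
  rw [kern_eq_mul]
  exact (integrable_exp_mul_gaussianReal _).const_mul _

theorem integral_exp_mul_gauss (t : ℝ) :
    ∫ y, Real.exp (t * y) ∂(gaussianReal 0 1) = Real.exp (t ^ 2 / 2) := by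
  have := congrFun (mgf_fun_id_gaussianReal (μ := 0) (v := 1)) t
  simpa [mgf] using this

theorem kern_mul_kern (s a b y : ℝ) :
    kern s a y * kern s b y = Real.exp (-s) * Real.exp ((Real.sqrt s * (a + b)) * y) := by
  rw [kern, kern, ← Real.exp_add, ← Real.exp_add]; ring_nf

theorem integrable_kern_mul_kern (s a b : ℝ) :
    Integrable (fun y => kern s a y * kern s b y) (gaussianReal 0 1) := by
  simp_rw [kern_mul_kern]
  exact (integrable_exp_mul_gaussianReal _).const_mul _

theorem integral_kern_mul_kern {s a b : ℝ} (hs : 0 ≤ s) (ha : a ^ 2 = 1) (hb : b ^ 2 = 1) :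
    ∫ y, kern s a y * kern s b y ∂(gaussianReal 0 1) = Real.exp (s * (a * b)) := by
  simp_rw [kern_mul_kern]
  rw [integral_const_mul, integral_exp_mul_gauss, ← Real.exp_add, mul_pow, Real.sq_sqrt hs]
  congr 1
  linear_combination s / 2 * ha + s / 2 * hb

theorem withDensity_kern {s a : ℝ} (hs : 0 ≤ s) (ha : a ^ 2 = 1) :
    (gaussianReal 0 1).withDensity (fun y => ENNReal.ofReal (kern s a y)) =
      (gaussianReal 0 1).map (fun z => Real.sqrt s * a + z) := by
  rw [gaussianReal_map_const_add, gaussianReal_of_var_ne_zero _ one_ne_zero,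
    gaussianReal_of_var_ne_zero _ one_ne_zero,
    ← withDensity_mul _ (by fun_prop) (by fun_prop)]
  congr 1
  funext y
  simp only [Pi.mul_apply, gaussianPDF]
  rw [← ENNReal.ofReal_mul (gaussianPDFReal_nonneg _ _ _)]
  congr 1
  simp only [gaussianPDFReal, kern]
  rw [mul_assoc, ← Real.exp_add]
  congr 2
  have : Real.sqrt s ^ 2 = s := Real.sq_sqrt hs
  simp only [NNReal.coe_one]
  linear_combination a ^ 2 / 2 * this + s / 2 * ha

theorem integral_kern {s a : ℝ} (hs : 0 ≤ s) (ha : a ^ 2 = 1) :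
    ∫ y, kern s a y ∂(gaussianReal 0 1) = 1 := by
  rw [kern_eq_mul, integral_const_mul, integral_exp_mul_gauss, ← Real.exp_add, mul_pow,
    Real.sq_sqrt hs, ha]
  simp

theorem integral_withDensity_kern {s a : ℝ} (H : ℝ → ℝ) :
    ∫ y, H y ∂((gaussianReal 0 1).withDensity (fun y => ENNReal.ofReal (kern s a y))) =
      ∫ y, kern s a y * H y ∂(gaussianReal 0 1) := by
  have := integral_withDensity_eq_integral_smul (μ := gaussianReal 0 1)
    (f := fun y => (kern s a y).toNNReal) (by fun_prop) H
  simp only [NNReal.smul_def, Real.coe_toNNReal _ (kern_pos s a _).le, smul_eq_mul] at this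
  exact this

theorem integrable_kern_mul_id {s a : ℝ} (hs : 0 ≤ s) (ha : a ^ 2 = 1) :
    Integrable (fun y => kern s a y * y) (gaussianReal 0 1) := by
  have h1 : Integrable (fun y : ℝ => y)
      ((gaussianReal 0 1).withDensity (fun y => ENNReal.ofReal (kern s a y))) := by
    rw [withDensity_kern hs ha, gaussianReal_map_const_add]
    exact (memLp_id_gaussianReal 1).integrable le_rfl
  have := (integrable_withDensity_iff_integrable_smul (μ := gaussianReal 0 1)
    (f := fun y => (kern s a y).toNNReal) (by fun_prop) (g := fun y : ℝ => y)).1 h1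
  simpa only [NNReal.smul_def, Real.coe_toNNReal _ (kern_pos s a _).le, smul_eq_mul] using this

theorem integral_kern_mul_id {s a : ℝ} (hs : 0 ≤ s) (ha : a ^ 2 = 1) :
    ∫ y, kern s a y * y ∂(gaussianReal 0 1) = Real.sqrt s * a := by
  rw [← integral_withDensity_kern (fun y => y), withDensity_kern hs ha,
    gaussianReal_map_const_add]
  simp

/-- The convex-combination-of-squares mixture of two independent standard Gaussians. -/
theorem map_mix_gauss {c : ℝ} (hc : c ^ 2 ≤ 1) :
    ((gaussianReal 0 1).prod (gaussianReal 0 1)).map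
      (fun p : ℝ × ℝ => c * p.1 + Real.sqrt (1 - c ^ 2) * p.2) = gaussianReal 0 1 := by
  have h : (fun p : ℝ × ℝ => c * p.1 + Real.sqrt (1 - c ^ 2) * p.2) =
      (fun q : ℝ × ℝ => q.1 + q.2) ∘
        Prod.map (fun x => c * x) (fun x => Real.sqrt (1 - c ^ 2) * x) := by
    funext p; rfl
  rw [h, ← Measure.map_map (by fun_prop) (by fun_prop),
    ← Measure.map_prod_map _ _ (by fun_prop) (by fun_prop), gaussianReal_map_const_mul,
    gaussianReal_map_const_mul]
  have := gaussianReal_conv_gaussianReal (m₁ := c * 0) (m₂ := Real.sqrt (1 - c ^ 2) * 0)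
    (v₁ := NNReal.mk (c ^ 2) (sq_nonneg _) * 1)
    (v₂ := NNReal.mk (Real.sqrt (1 - c ^ 2) ^ 2) (sq_nonneg _) * 1)
  rw [Measure.conv] at this
  rw [this]
  congr 1
  · simp
  · ext
    simp [Real.sq_sqrt (sub_nonneg.2 hc)]

variable {K : Type*} [Fintype K]

/-- Coordinatewise mixture of two vectors. -/
def mix (c : K → ℝ) (y z : K → ℝ) : K → ℝ :=
  fun k => c k * y k + Real.sqrt (1 - c k ^ 2) * z k

/-- Used in two ways: with `c k = √(s k / s' k)` it adds noise to channels, and with `c` equal to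
`0` at one coordinate and `1` elsewhere it resamples that coordinate. -/
theorem measurePreserving_mix {c : K → ℝ} (hc : ∀ k, c k ^ 2 ≤ 1) :
    MeasurePreserving (fun p : (K → ℝ) × (K → ℝ) => mix c p.1 p.2)
      ((gaussPi K).prod (gaussPi K)) (gaussPi K) := by
  have h1 := (measurePreserving_arrowProdEquivProdArrow ℝ ℝ K
    (fun _ => gaussianReal 0 1) (fun _ => gaussianReal 0 1)).symm
  have h2 : MeasurePreserving
      (fun (p : K → ℝ × ℝ) k => c k * (p k).1 + Real.sqrt (1 - c k ^ 2) * (p k).2)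
      (Measure.pi fun _ : K => (gaussianReal 0 1).prod (gaussianReal 0 1)) (gaussPi K) :=
    measurePreserving_pi (f := fun k (p : ℝ × ℝ) => c k * p.1 + Real.sqrt (1 - c k ^ 2) * p.2)
      _ _ (fun k => ⟨by fun_prop, map_mix_gauss (hc k)⟩)
  exact h2.comp h1

theorem integrable_mix {c : K → ℝ} (hc : ∀ k, c k ^ 2 ≤ 1) {F : (K → ℝ) → ℝ}
    (hF : Integrable F (gaussPi K)) :
    Integrable (fun p : (K → ℝ) × (K → ℝ) => F (mix c p.1 p.2))
      ((gaussPi K).prod (gaussPi K)) :=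
  (measurePreserving_mix hc).integrable_comp_of_integrable hF

theorem integral_mix {c : K → ℝ} (hc : ∀ k, c k ^ 2 ≤ 1) {F : (K → ℝ) → ℝ}
    (hF : Integrable F (gaussPi K)) :
    ∫ y, F y ∂(gaussPi K) = ∫ y, ∫ z, F (mix c y z) ∂(gaussPi K) ∂(gaussPi K) := by
  rw [← integral_prod _ (integrable_mix hc hF)]
  conv_lhs => rw [← (measurePreserving_mix hc).map_eq]
  refine integral_map (measurePreserving_mix hc).measurable.aemeasurable ?_
  rw [(measurePreserving_mix hc).map_eq]
  exact hF.1

theorem pi_withDensity_kern (s a : K → ℝ) :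
    (gaussPi K).withDensity (fun y => ENNReal.ofReal (∏ k, kern (s k) (a k) (y k))) =
      Measure.pi fun k =>
        (gaussianReal 0 1).withDensity (fun y => ENNReal.ofReal (kern (s k) (a k) y)) := by
  have hfin : ∀ k, IsFiniteMeasure
      ((gaussianReal 0 1).withDensity (fun y => ENNReal.ofReal (kern (s k) (a k) y))) :=
    fun k => isFiniteMeasure_withDensity_ofReal (integrable_kern _ _).2
  refine (Measure.pi_eq fun B hB => ?_).symm
  rw [withDensity_apply _ (MeasurableSet.univ_pi hB),
    ← lintegral_indicator (MeasurableSet.univ_pi hB)]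
  have h : ∀ y : K → ℝ, (Set.univ.pi B).indicator
      (fun y => ENNReal.ofReal (∏ k, kern (s k) (a k) (y k))) y =
      ∏ k, (B k).indicator (fun y => ENNReal.ofReal (kern (s k) (a k) y)) (y k) := by
    intro y
    by_cases hy : y ∈ Set.univ.pi B
    · rw [Set.indicator_of_mem hy, ENNReal.ofReal_prod_of_nonneg fun k _ => (kern_pos _ _ _).le]
      exact Finset.prod_congr rfl fun k _ => by
        rw [Set.indicator_of_mem (hy k (Set.mem_univ k))]
    · rw [Set.indicator_of_notMem hy]
      simp only [Set.mem_pi, Set.mem_univ, true_imp_iff, not_forall] at hy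
      obtain ⟨k, hk⟩ := hy
      exact (Finset.prod_eq_zero (Finset.mem_univ k) (Set.indicator_of_notMem hk _)).symm
  simp_rw [h]
  have hm : ∀ k, Measurable ((B k).indicator fun y => ENNReal.ofReal (kern (s k) (a k) y)) :=
    fun k => Measurable.indicator (by fun_prop) (hB k)
  rw [lintegral_prod_eq_prod_lintegral_of_indepFun Finset.univ
    (fun k (y : K → ℝ) => (B k).indicator (fun y => ENNReal.ofReal (kern (s k) (a k) y)) (y k))
    (iIndepFun_pi fun k => (hm k).aemeasurable)
    (fun k => (hm k).comp (measurable_pi_apply k))]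
  refine Finset.prod_congr rfl fun k _ => ?_
  rw [withDensity_apply _ (hB k), ← lintegral_indicator (hB k)]
  exact (measurePreserving_eval (fun _ : K => gaussianReal 0 1) k).lintegral_comp (hm k)

/-- The Cameron-Martin formula for a shift by a vector of signs with weights. -/
theorem integral_shift_gaussPi {s a : K → ℝ} (hs : ∀ k, 0 ≤ s k) (ha : ∀ k, a k ^ 2 = 1)
    {H : (K → ℝ) → ℝ} (hH : Measurable H) :
    ∫ z, H (fun k => Real.sqrt (s k) * a k + z k) ∂(gaussPi K) =
      ∫ y, (∏ k, kern (s k) (a k) (y k)) * H y ∂(gaussPi K) := by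
  have h1 : (gaussPi K).map (fun z k => Real.sqrt (s k) * a k + z k) =
      (gaussPi K).withDensity (fun y => ENNReal.ofReal (∏ k, kern (s k) (a k) (y k))) := by
    have hp : ∀ k, IsProbabilityMeasure
        ((gaussianReal 0 1).map (fun z => Real.sqrt (s k) * a k + z)) := fun k =>
      Measure.isProbabilityMeasure_map (by fun_prop)
    rw [pi_withDensity_kern]
    simp_rw [withDensity_kern (hs _) (ha _)]
    exact Measure.pi_map_pi (f := fun k z => Real.sqrt (s k) * a k + z)
      (fun k => by fun_prop)
  have hpos : ∀ y : K → ℝ, 0 ≤ ∏ k, kern (s k) (a k) (y k) := fun y =>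
    Finset.prod_nonneg fun k _ => (kern_pos _ _ _).le
  rw [← integral_map (φ := fun (z : K → ℝ) k => Real.sqrt (s k) * a k + z k)
    (measurable_pi_iff.2 fun k => by fun_prop).aemeasurable hH.aestronglyMeasurable, h1]
  have := integral_withDensity_eq_integral_smul (μ := gaussPi K)
    (f := fun y => (∏ k, kern (s k) (a k) (y k)).toNNReal) (by fun_prop) H
  simp only [NNReal.smul_def, Real.coe_toNNReal _ (hpos _), smul_eq_mul] at this
  exact this

theorem kern_degrade {s s' a : ℝ} (hs : 0 ≤ s) (hss : s ≤ s') (ha : a ^ 2 = 1) (y : ℝ) :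
    ∫ z, kern s' a (Real.sqrt (s / s') * y + Real.sqrt (1 - Real.sqrt (s / s') ^ 2) * z)
      ∂(gaussianReal 0 1) = kern s a y := by
  have hs' : 0 ≤ s' := hs.trans hss
  have hc : Real.sqrt (s / s') ^ 2 = s / s' := Real.sq_sqrt (div_nonneg hs hs')
  -- If `s' = 0`, the quotient takes the default value `0`, which is right because then `s = 0`.
  have hmul : s' * (s / s') = s := by
    rcases hs'.eq_or_lt with h | h
    · rw [← h] at hss ⊢; linarith
    · field_simp
  have h1 : Real.sqrt s' * Real.sqrt (s / s') = Real.sqrt s := by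
    rw [← Real.sqrt_mul hs', hmul]
  have h2 : (Real.sqrt s' * Real.sqrt (1 - s / s')) ^ 2 = s' - s := by
    rw [mul_pow, Real.sq_sqrt hs', Real.sq_sqrt (sub_nonneg.2 (div_le_one_of_le₀ hss hs'))]
    linear_combination -hmul
  rw [hc]
  have h3 : ∀ z, kern s' a (Real.sqrt (s / s') * y + Real.sqrt (1 - s / s') * z) =
      Real.exp (Real.sqrt s * a * y - s' / 2) *
        Real.exp ((Real.sqrt s' * Real.sqrt (1 - s / s') * a) * z) := by
    intro z
    rw [kern, ← Real.exp_add, ← h1]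
    ring_nf
  simp_rw [h3]
  rw [integral_const_mul, integral_exp_mul_gauss, ← Real.exp_add, kern, mul_pow, h2, ha]
  ring_nf

end

/-! ### Posterior moments, entropy and overlap for a finite family of channels. -/

noncomputable section

/-- For `t > 0` one has `t - 1 ≤ t log t ≤ t²`, so square integrability suffices. -/
theorem integrable_mul_log {α : Type*} [MeasurableSpace α] {μ : Measure α} [IsFiniteMeasure μ]
    {f : α → ℝ} (hf : ∀ a, 0 < f a) (hm : Measurable f) (hi : Integrable (fun a => f a ^ 2) μ) :
    Integrable (fun a => f a * Real.log (f a)) μ := by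
  refine (hi.add (integrable_const 1)).mono'
    (Measurable.aestronglyMeasurable (by fun_prop)) (ae_of_all _ fun a => ?_)
  have h := hf a
  simp only [Pi.add_apply]
  set t := f a
  have h1 : Real.log t ≤ t := (Real.log_le_sub_one_of_pos h).trans (by linarith)
  have h2 : 1 - t⁻¹ ≤ Real.log t := Real.one_sub_inv_le_log_of_pos h
  have h3 : t * (1 - t⁻¹) = t - 1 := by field_simp
  rw [Real.norm_eq_abs, abs_le]
  constructor
  · nlinarith [mul_le_mul_of_nonneg_left h2 h.le]
  · nlinarith [mul_le_mul_of_nonneg_left h1 h.le]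

variable {K Θ : Type*} [Fintype K]

/-- The likelihood of `θ` given the outputs `y` of Gaussian channels with inputs `x k θ` and
signal-to-noise ratios `s k`. -/
def lik (x : K → Θ → ℝ) (s : K → ℝ) (θ : Θ) (y : K → ℝ) : ℝ :=
  ∏ k, kern (s k) (x k θ) (y k)

theorem lik_pos (x : K → Θ → ℝ) (s : K → ℝ) (θ : Θ) (y : K → ℝ) : 0 < lik x s θ y :=
  Finset.prod_pos fun _ _ => kern_pos _ _ _

@[fun_prop]
theorem measurable_lik (x : K → Θ → ℝ) (s : K → ℝ) (θ : Θ) : Measurable (lik x s θ) := by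
  unfold lik; fun_prop

theorem integrable_lik (x : K → Θ → ℝ) (s : K → ℝ) (θ : Θ) :
    Integrable (lik x s θ) (gaussPi K) :=
  Integrable.fintype_prod (f := fun k => kern (s k) (x k θ)) fun _ => integrable_kern _ _

theorem integrable_lik_mul_lik (x : K → Θ → ℝ) (s : K → ℝ) (θ θ' : Θ) :
    Integrable (fun y => lik x s θ y * lik x s θ' y) (gaussPi K) := by
  simp_rw [lik, ← Finset.prod_mul_distrib]
  exact Integrable.fintype_prod (f := fun k y => kern (s k) (x k θ) y * kern (s k) (x k θ') y)
    fun _ => integrable_kern_mul_kern _ _ _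

theorem integral_lik {x : K → Θ → ℝ} (hx : ∀ k θ, x k θ ^ 2 = 1) {s : K → ℝ} (hs : ∀ k, 0 ≤ s k)
    (θ : Θ) : ∫ y, lik x s θ y ∂(gaussPi K) = 1 := by
  have := integral_fintype_prod_eq_prod (𝕜 := ℝ) (fun k => kern (s k) (x k θ))
    (μ := fun _ : K => gaussianReal 0 1)
  simp_rw [integral_kern (hs _) (hx _ _), Finset.prod_const_one] at this
  exact this

variable [Fintype Θ]

/-- The unnormalized posterior expectation of `g`, for prior weights `w`. -/
def mom (w : Θ → ℝ) (x : K → Θ → ℝ) (s : K → ℝ) (g : Θ → ℝ) (y : K → ℝ) : ℝ :=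
  ∑ θ, w θ * g θ * lik x s θ y

/-- The relative entropy (up to a constant) of the channel outputs with respect to pure noise. -/
def ent (w : Θ → ℝ) (x : K → Θ → ℝ) (s : K → ℝ) : ℝ :=
  ∫ y, mom w x s 1 y * Real.log (mom w x s 1 y) ∂(gaussPi K)

/-- The second moment of the posterior expectation of `g`. -/
def ovl (w : Θ → ℝ) (x : K → Θ → ℝ) (s : K → ℝ) (g : Θ → ℝ) : ℝ :=
  ∫ y, mom w x s g y ^ 2 / mom w x s 1 y ∂(gaussPi K)

@[fun_prop]
theorem measurable_mom (w : Θ → ℝ) (x : K → Θ → ℝ) (s : K → ℝ) (g : Θ → ℝ) :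
    Measurable (mom w x s g) := by
  unfold mom; fun_prop

theorem integrable_mom (w : Θ → ℝ) (x : K → Θ → ℝ) (s : K → ℝ) (g : Θ → ℝ) :
    Integrable (mom w x s g) (gaussPi K) :=
  integrable_finsetSum _ fun θ _ => (integrable_lik x s θ).const_mul _

theorem integrable_mom_sq (w : Θ → ℝ) (x : K → Θ → ℝ) (s : K → ℝ) (g : Θ → ℝ) :
    Integrable (fun y => mom w x s g y ^ 2) (gaussPi K) := by
  simp_rw [mom, sq, Finset.sum_mul_sum]
  refine integrable_finsetSum _ fun θ _ => integrable_finsetSum _ fun θ' _ => ?_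
  convert! (integrable_lik_mul_lik x s θ θ').const_mul (w θ * g θ * (w θ' * g θ')) using 2
  ring

theorem integral_mom {x : K → Θ → ℝ} (hx : ∀ k θ, x k θ ^ 2 = 1) {s : K → ℝ}
    (hs : ∀ k, 0 ≤ s k) (w g : Θ → ℝ) :
    ∫ y, mom w x s g y ∂(gaussPi K) = ∑ θ, w θ * g θ := by
  unfold mom
  rw [integral_finsetSum _ fun θ _ => (integrable_lik x s θ).const_mul _]
  exact Finset.sum_congr rfl fun θ _ => by rw [integral_const_mul, integral_lik hx hs, mul_one]

/-- Degrading the channels: lower signal-to-noise ratios are obtained by adding noise. -/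
theorem mom_degrade {x : K → Θ → ℝ} (hx : ∀ k θ, x k θ ^ 2 = 1) {s s' : K → ℝ}
    (hs : ∀ k, 0 ≤ s k) (hss : ∀ k, s k ≤ s' k) (g : Θ → ℝ) (y : K → ℝ)
    (hint : ∀ θ, Integrable (fun z => lik x s' θ (mix (fun k => Real.sqrt (s k / s' k)) y z))
      (gaussPi K)) :
    ∫ z, mom w x s' g (mix (fun k => Real.sqrt (s k / s' k)) y z) ∂(gaussPi K) =
      mom w x s g y := by
  unfold mom
  rw [integral_finsetSum _ fun θ _ => (hint θ).const_mul _]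
  refine Finset.sum_congr rfl fun θ _ => ?_
  rw [integral_const_mul]
  congr 1
  have := integral_fintype_prod_eq_prod (𝕜 := ℝ)
    (fun k z => kern (s' k) (x k θ)
      (Real.sqrt (s k / s' k) * y k + Real.sqrt (1 - Real.sqrt (s k / s' k) ^ 2) * z))
    (μ := fun _ : K => gaussianReal 0 1)
  simp_rw [kern_degrade (hs _) (hss _) (hx _ _)] at this
  exact this

theorem abs_mom_le {w : Θ → ℝ} (hw : ∀ θ, 0 < w θ) {g : Θ → ℝ} (hg : ∀ θ, |g θ| ≤ 1) (x : K → Θ → ℝ) (s : K → ℝ) (y : K → ℝ) :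
    |mom w x s g y| ≤ mom w x s 1 y := by
  refine (Finset.abs_sum_le_sum_abs _ _).trans (Finset.sum_le_sum fun θ _ => ?_)
  rw [abs_mul, abs_mul, abs_of_pos (hw θ), abs_of_pos (lik_pos x s θ y)]
  exact mul_le_mul_of_nonneg_right (mul_le_mul_of_nonneg_left (hg θ) (hw θ).le)
    (lik_pos x s θ y).le

section Positive

variable [Nonempty Θ] {w : Θ → ℝ} (hw : ∀ θ, 0 < w θ)
include hw

theorem mom_one_pos (x : K → Θ → ℝ) (s : K → ℝ) (y : K → ℝ) : 0 < mom w x s 1 y :=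
  Finset.sum_pos (fun θ _ => by
    have := hw θ; have := lik_pos x s θ y; simp only [Pi.one_apply]; positivity)
    Finset.univ_nonempty

theorem mom_sq_div_le {g : Θ → ℝ} (hg : ∀ θ, |g θ| ≤ 1) (x : K → Θ → ℝ) (s : K → ℝ)
    (y : K → ℝ) : mom w x s g y ^ 2 / mom w x s 1 y ≤ mom w x s 1 y := by
  have h := mom_one_pos hw x s y
  rw [div_le_iff₀ h, ← sq]
  exact sq_le_sq.2 (by rw [abs_of_pos h]; exact abs_mom_le hw hg x s y)

theorem integrable_mom_sq_div {g : Θ → ℝ} (hg : ∀ θ, |g θ| ≤ 1) (x : K → Θ → ℝ) (s : K → ℝ) :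
    Integrable (fun y => mom w x s g y ^ 2 / mom w x s 1 y) (gaussPi K) := by
  refine (integrable_mom w x s 1).mono'
    (Measurable.aestronglyMeasurable (by fun_prop)) (ae_of_all _ fun y => ?_)
  rw [Real.norm_of_nonneg (div_nonneg (sq_nonneg _) (mom_one_pos hw x s y).le)]
  exact mom_sq_div_le hw hg x s y

theorem ovl_nonneg (x : K → Θ → ℝ) (s : K → ℝ) (g : Θ → ℝ) : 0 ≤ ovl w x s g :=
  integral_nonneg fun y => div_nonneg (sq_nonneg _) (mom_one_pos hw x s y).le

theorem ovl_le {x : K → Θ → ℝ} (hx : ∀ k θ, x k θ ^ 2 = 1) {s : K → ℝ} (hs : ∀ k, 0 ≤ s k)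
    {g : Θ → ℝ} (hg : ∀ θ, |g θ| ≤ 1) : ovl w x s g ≤ ∑ θ, w θ := by
  have := integral_mom hx hs w 1
  simp only [Pi.one_apply, mul_one] at this
  rw [← this]
  exact integral_mono (integrable_mom_sq_div hw hg x s) (integrable_mom w x s 1)
    fun y => mom_sq_div_le hw hg x s y

theorem integrable_mom_log (x : K → Θ → ℝ) (s : K → ℝ) :
    Integrable (fun y => mom w x s 1 y * Real.log (mom w x s 1 y)) (gaussPi K) :=
  integrable_mul_log (mom_one_pos hw x s) (by fun_prop) (integrable_mom_sq w x s 1)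

/-- Jensen's inequality for the convex function `(G, F) ↦ G² / F`: the moments at `s` are averages
over added noise of the moments at `s'`. Convexity enters through the tangent bound `G'² / F' ≥ 2 λ
G' - λ² F'` with `λ = G / F`. -/
theorem ovl_mono {x : K → Θ → ℝ} (hx : ∀ k θ, x k θ ^ 2 = 1) {s s' : K → ℝ}
    (hs : ∀ k, 0 ≤ s k) (hss : ∀ k, s k ≤ s' k) {g : Θ → ℝ} (hg : ∀ θ, |g θ| ≤ 1) :
    ovl w x s g ≤ ovl w x s' g := by
  set c : K → ℝ := fun k => Real.sqrt (s k / s' k) with hc_def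
  have hc : ∀ k, c k ^ 2 ≤ 1 := fun k => by
    rw [hc_def]
    simp only
    rw [Real.sq_sqrt (div_nonneg (hs k) ((hs k).trans (hss k)))]
    exact div_le_one_of_le₀ (hss k) ((hs k).trans (hss k))
  have hI := integrable_mix hc (integrable_mom_sq_div hw hg x s')
  rw [ovl, ovl, integral_mix hc (integrable_mom_sq_div hw hg x s')]
  refine integral_mono_ae (integrable_mom_sq_div hw hg x s) hI.integral_prod_left ?_
  -- Fubini gives integrability of the sections only for almost every `y`.
  have hl : ∀ᵐ y ∂(gaussPi K), ∀ θ, Integrable (fun z => lik x s' θ (mix c y z)) (gaussPi K) :=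
    ae_all_iff.2 fun θ => (integrable_mix hc (integrable_lik x s' θ)).prod_right_ae
  have hm : ∀ h : Θ → ℝ, ∀ᵐ y ∂(gaussPi K),
      Integrable (fun z => mom w x s' h (mix c y z)) (gaussPi K) := fun h =>
    (integrable_mix hc (integrable_mom w x s' h)).prod_right_ae
  filter_upwards [hl, hI.prod_right_ae, hm g, hm 1] with y hl hq hmg hm1
  have eg := mom_degrade (w := w) hx hs hss g y hl
  have e1 := mom_degrade (w := w) hx hs hss 1 y hl
  have hF := mom_one_pos hw x s y
  set F := mom w x s 1 y
  set G := mom w x s g y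
  have key : ∫ z, (2 * (G / F) * mom w x s' g (mix c y z) -
      (G / F) ^ 2 * mom w x s' 1 (mix c y z)) ∂(gaussPi K) ≤
      ∫ z, mom w x s' g (mix c y z) ^ 2 / mom w x s' 1 (mix c y z) ∂(gaussPi K) := by
    refine integral_mono ((hmg.const_mul _).sub (hm1.const_mul _)) hq fun z => ?_
    have h := mom_one_pos hw x s' (mix c y z)
    simp only
    rw [le_div_iff₀ h]
    nlinarith [sq_nonneg (mom w x s' g (mix c y z) - G / F * mom w x s' 1 (mix c y z))]
  rw [integral_sub (hmg.const_mul _) (hm1.const_mul _), integral_const_mul, integral_const_mul,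
    eg, e1] at key
  refine le_trans (le_of_eq ?_) key
  field_simp
  ring

end Positive

end

/-! ### The entropy gained by opening channels. -/

noncomputable section

/-- The mixture with total mass `F` and mean `G / F` of the two signals in a channel. -/
def signMix (t F G z : ℝ) : ℝ := (F + G) / 2 * kern t 1 z + (F - G) / 2 * kern t (-1) z

@[fun_prop]
theorem measurable_signMix (t F G : ℝ) : Measurable (signMix t F G) := by unfold signMix; fun_prop

theorem signMix_pos {F G : ℝ} (hF : 0 < F) (hG : |G| ≤ F) (t z : ℝ) : 0 < signMix t F G z := by
  obtain ⟨h1, h2⟩ := abs_le.1 hG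
  have k1 := kern_pos t 1 z
  have k2 := kern_pos t (-1) z
  unfold signMix
  rcases lt_or_ge 0 G with h | h
  · have := mul_pos (show 0 < (F + G) / 2 by linarith) k1
    have := mul_nonneg (show 0 ≤ (F - G) / 2 by linarith) k2.le
    linarith
  · have := mul_nonneg (show 0 ≤ (F + G) / 2 by linarith) k1.le
    have := mul_pos (show 0 < (F - G) / 2 by linarith) k2
    linarith

theorem integrable_signMix (t F G : ℝ) : Integrable (signMix t F G) (gaussianReal 0 1) :=
  ((integrable_kern t 1).const_mul _).add ((integrable_kern t (-1)).const_mul _)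

theorem integral_signMix {t : ℝ} (ht : 0 ≤ t) (F G : ℝ) :
    ∫ z, signMix t F G z ∂(gaussianReal 0 1) = F := by
  unfold signMix
  rw [integral_add ((integrable_kern t 1).const_mul _) ((integrable_kern t (-1)).const_mul _),
    integral_const_mul, integral_const_mul, integral_kern ht (by norm_num),
    integral_kern ht (by norm_num)]
  ring

theorem signMix_mul_id (t F G : ℝ) : (fun z => signMix t F G z * z) =
    fun z => (F + G) / 2 * (kern t 1 z * z) + (F - G) / 2 * (kern t (-1) z * z) := by
  funext z; unfold signMix; ring

theorem integrable_signMix_mul_id {t : ℝ} (ht : 0 ≤ t) (F G : ℝ) :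
    Integrable (fun z => signMix t F G z * z) (gaussianReal 0 1) := by
  rw [signMix_mul_id]
  exact ((integrable_kern_mul_id ht (by norm_num)).const_mul _).add
    ((integrable_kern_mul_id ht (by norm_num)).const_mul _)

theorem integral_signMix_mul_id {t : ℝ} (ht : 0 ≤ t) (F G : ℝ) :
    ∫ z, signMix t F G z * z ∂(gaussianReal 0 1) = Real.sqrt t * G := by
  rw [signMix_mul_id, integral_add ((integrable_kern_mul_id ht (by norm_num)).const_mul _)
    ((integrable_kern_mul_id ht (by norm_num)).const_mul _), integral_const_mul,
    integral_const_mul, integral_kern_mul_id ht (by norm_num),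
    integral_kern_mul_id ht (by norm_num)]
  ring

theorem signMix_sq (t F G : ℝ) : (fun z => signMix t F G z ^ 2) =
    fun z => ((F + G) ^ 2 / 4 * (kern t 1 z * kern t 1 z) +
      (F ^ 2 - G ^ 2) / 2 * (kern t 1 z * kern t (-1) z)) +
      (F - G) ^ 2 / 4 * (kern t (-1) z * kern t (-1) z) := by
  funext z; unfold signMix; ring

theorem integrable_signMix_sq (t F G : ℝ) :
    Integrable (fun z => signMix t F G z ^ 2) (gaussianReal 0 1) := by
  rw [signMix_sq]
  exact (((integrable_kern_mul_kern _ _ _).const_mul _).add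
    ((integrable_kern_mul_kern _ _ _).const_mul _)).add
    ((integrable_kern_mul_kern _ _ _).const_mul _)

theorem integral_signMix_sq {t : ℝ} (ht : 0 ≤ t) (F G : ℝ) :
    ∫ z, signMix t F G z ^ 2 ∂(gaussianReal 0 1) = F ^ 2 * Real.cosh t + G ^ 2 * Real.sinh t := by
  have i (c a b : ℝ) : Integrable (fun z => c * (kern t a z * kern t b z)) (gaussianReal 0 1) :=
    (integrable_kern_mul_kern _ _ _).const_mul _
  have i2 : Integrable (fun z => (F + G) ^ 2 / 4 * (kern t 1 z * kern t 1 z) +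
      (F ^ 2 - G ^ 2) / 2 * (kern t 1 z * kern t (-1) z)) (gaussianReal 0 1) := (i _ _ _).add (i _ _ _)
  rw [signMix_sq, integral_add i2 (i _ _ _), integral_add (i _ _ _) (i _ _ _),
    integral_const_mul, integral_const_mul,
    integral_const_mul, integral_kern_mul_kern ht (by norm_num) (by norm_num),
    integral_kern_mul_kern ht (by norm_num) (by norm_num),
    integral_kern_mul_kern ht (by norm_num) (by norm_num), Real.cosh_eq, Real.sinh_eq]
  norm_num
  ring

theorem integrable_signMix_log {F G : ℝ} (hF : 0 < F) (hG : |G| ≤ F) (t : ℝ) :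
    Integrable (fun z => signMix t F G z * Real.log (signMix t F G z)) (gaussianReal 0 1) :=
  integrable_mul_log (signMix_pos hF hG t) (by fun_prop) (integrable_signMix_sq t F G)

/-- Relative entropy is at most the chi-square divergence: `log (R / F) ≤ R / F - 1` for the mixture
`R`, whose second moment is explicit. -/
theorem integral_signMix_log_le {t F G : ℝ} (ht : 0 ≤ t) (hF : 0 < F) (hG : |G| ≤ F) :
    ∫ z, signMix t F G z * Real.log (signMix t F G z) ∂(gaussianReal 0 1) ≤
      F * Real.log F + (Real.sinh t * (G ^ 2 / F) + F * (Real.cosh t - 1)) := by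
  have i1 := (integrable_signMix t F G).const_mul (Real.log F - 1)
  have i2 := (integrable_signMix_sq t F G).const_mul F⁻¹
  calc _ ≤ ∫ z, ((Real.log F - 1) * signMix t F G z + F⁻¹ * signMix t F G z ^ 2)
        ∂(gaussianReal 0 1) := by
        refine integral_mono (integrable_signMix_log hF hG t) (i1.add i2) fun z => ?_
        have hR := signMix_pos hF hG t z
        set R := signMix t F G z
        have h := Real.log_le_sub_one_of_pos (div_pos hR hF)
        rw [Real.log_div hR.ne' hF.ne'] at h
        have h2 := mul_le_mul_of_nonneg_left h hR.le
        have h3 : R * (R / F - 1) = F⁻¹ * R ^ 2 - R := by field_simp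
        rw [h3] at h2
        simp only
        linarith
    _ = _ := by
        rw [integral_add i1 i2, integral_const_mul, integral_const_mul, integral_signMix ht,
          integral_signMix_sq ht]
        field_simp
        ring

/-- Gibbs' inequality `R log R ≥ R log ρ + R - ρ`, where `ρ` is the density of a shifted Gaussian
with the same mass `F` and the same mean `a = √t G / F` as the mixture `R`. -/
theorem le_integral_signMix_log {t F G : ℝ} (ht : 0 ≤ t) (hF : 0 < F) (hG : |G| ≤ F) :
    F * Real.log F + t / 2 * (G ^ 2 / F) ≤
      ∫ z, signMix t F G z * Real.log (signMix t F G z) ∂(gaussianReal 0 1) := by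
  set a := Real.sqrt t * (G / F) with ha
  have i1 := (integrable_signMix t F G).const_mul (Real.log F - a ^ 2 / 2 + 1)
  have i2 := (integrable_signMix_mul_id ht F G).const_mul a
  have i3 : Integrable (fun z => F * Real.exp (-(a ^ 2 / 2)) * Real.exp (a * z))
    (gaussianReal 0 1) := (integrable_exp_mul_gaussianReal a).const_mul _
  have i12 : Integrable (fun z => (Real.log F - a ^ 2 / 2 + 1) * signMix t F G z +
    a * (signMix t F G z * z)) (gaussianReal 0 1) := i1.add i2
  calc _ = ∫ z, (((Real.log F - a ^ 2 / 2 + 1) * signMix t F G z + a * (signMix t F G z * z)) -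
        F * Real.exp (-(a ^ 2 / 2)) * Real.exp (a * z)) ∂(gaussianReal 0 1) := by
        rw [integral_sub i12 i3, integral_add i1 i2, integral_const_mul,
          integral_const_mul, integral_const_mul, integral_signMix ht,
          integral_signMix_mul_id ht, integral_exp_mul_gauss, mul_assoc F, ← Real.exp_add]
        have h1 : a ^ 2 = t * (G / F) ^ 2 := by rw [ha, mul_pow, Real.sq_sqrt ht]
        have h2 : a * (Real.sqrt t * G) = t * (G ^ 2 / F) := by
          have := Real.sq_sqrt ht
          rw [ha]
          field_simp
          linear_combination G ^ 2 * this
        rw [h2, neg_add_cancel, Real.exp_zero, h1]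
        field_simp
        ring
    _ ≤ _ := by
        refine integral_mono (i12.sub i3) (integrable_signMix_log hF hG t) fun z => ?_
        have hR := signMix_pos hF hG t z
        simp only
        set R := signMix t F G z
        set ρ := F * Real.exp (-(a ^ 2 / 2)) * Real.exp (a * z) with hρ
        have hρ0 : 0 < ρ := by positivity
        have hl : Real.log ρ = Real.log F - a ^ 2 / 2 + a * z := by
          rw [hρ, Real.log_mul (by positivity) (by positivity), Real.log_mul hF.ne' (by positivity),
            Real.log_exp, Real.log_exp]
          ring
        have h := Real.log_le_sub_one_of_pos (div_pos hρ0 hR)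
        rw [Real.log_div hρ0.ne' hR.ne', hl] at h
        have h2 := mul_le_mul_of_nonneg_left h hR.le
        have h3 : R * (ρ / R - 1) = ρ - R := by field_simp
        rw [h3] at h2
        nlinarith

theorem kern_sign {a : ℝ} (ha : a ^ 2 = 1) (t z : ℝ) :
    kern t a z = (1 + a) / 2 * kern t 1 z + (1 - a) / 2 * kern t (-1) z := by
  rcases sq_eq_one_iff.1 ha with rfl | rfl <;> ring

theorem abs_sign_le {K Θ : Type*} {x : K → Θ → ℝ} (hx : ∀ k θ, x k θ ^ 2 = 1) (k : K) (θ : Θ) :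
    |x k θ| ≤ 1 :=
  (sq_le_one_iff_abs_le_one _).1 (hx k θ).le

/-- The signal-to-noise ratios `s`, changed to `t` on the channels in `S`. -/
def opened {K : Type*} [DecidableEq K] (s : K → ℝ) (S : Finset K) (t : ℝ) : K → ℝ :=
  fun j => if j ∈ S then t else s j

section Opened

variable {K : Type*} [DecidableEq K] {s : K → ℝ} {S : Finset K} {t : ℝ}

theorem opened_empty : opened s ∅ t = s := by funext j; simp [opened]

theorem opened_insert (k : K) :
    opened s (insert k S) t = Function.update (opened s S t) k t := by
  funext j
  by_cases h : j = k <;> simp [opened, h]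

theorem opened_nonneg (hs : ∀ k, 0 ≤ s k) (ht : 0 ≤ t) (k : K) : 0 ≤ opened s S t k := by
  unfold opened; split_ifs; exacts [ht, hs k]

theorem le_opened (hS : ∀ k ∈ S, s k = 0) (ht : 0 ≤ t) (k : K) : s k ≤ opened s S t k := by
  unfold opened; split_ifs with h; exacts [(hS k h).trans_le ht, le_rfl]

theorem opened_apply_of_notMem {k : K} (hk : k ∉ S) : opened s S t k = s k := by
  simp [opened, hk]

end Opened

variable {K Θ : Type*} [Fintype K] [DecidableEq K]

/-- These mixing coefficients replace coordinate `k` by `z k` and keep the others. At ratio `0` the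
old coordinate `k` did not enter the likelihood, so opening the channel only adds one factor. -/
theorem lik_update {s : K → ℝ} {k : K} (hk : s k = 0) (t : ℝ) (x : K → Θ → ℝ) (θ : Θ)
    (y z : K → ℝ) :
    lik x (Function.update s k t) θ (mix (fun j => if j = k then 0 else 1) y z) =
      lik x s θ y * kern t (x k θ) (z k) := by
  unfold lik
  rw [← Finset.mul_prod_erase Finset.univ _ (Finset.mem_univ k),
    ← Finset.mul_prod_erase Finset.univ (fun j => kern (s j) (x j θ) (y j)) (Finset.mem_univ k),
    hk, kern_zero, one_mul, mul_comm]
  congr 1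
  · refine Finset.prod_congr rfl fun j hj => ?_
    have hj : j ≠ k := Finset.ne_of_mem_erase hj
    simp [mix, hj]
  · simp [mix]

variable [Fintype Θ]

theorem mom_update {s : K → ℝ} {k : K} (hk : s k = 0) (t : ℝ) {x : K → Θ → ℝ}
    (hx : ∀ k θ, x k θ ^ 2 = 1) (w : Θ → ℝ) (y z : K → ℝ) :
    mom w x (Function.update s k t) 1 (mix (fun j => if j = k then 0 else 1) y z) =
      signMix t (mom w x s 1 y) (mom w x s (x k) y) (z k) := by
  unfold mom signMix
  rw [← Finset.sum_add_distrib, ← Finset.sum_sub_distrib, Finset.sum_div, Finset.sum_div,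
    Finset.sum_mul, Finset.sum_mul, ← Finset.sum_add_distrib]
  refine Finset.sum_congr rfl fun θ _ => ?_
  rw [lik_update hk, kern_sign (hx k θ)]
  simp only [Pi.one_apply]
  ring

variable [Nonempty Θ] {w : Θ → ℝ} (hw : ∀ θ, 0 < w θ) {x : K → Θ → ℝ}
  (hx : ∀ k θ, x k θ ^ 2 = 1)
include hw hx

/-- The chain rule for entropy: given the other outputs, the new output has the two-point mixture
`signMix` as its density, so the gain reduces to a one-dimensional integral. -/
theorem ent_update {s : K → ℝ} {k : K} (hk : s k = 0) (t : ℝ) :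
    Integrable (fun y => ∫ z, signMix t (mom w x s 1 y) (mom w x s (x k) y) z *
      Real.log (signMix t (mom w x s 1 y) (mom w x s (x k) y) z) ∂(gaussianReal 0 1))
      (gaussPi K) ∧
    ent w x (Function.update s k t) =
      ∫ y, ∫ z, signMix t (mom w x s 1 y) (mom w x s (x k) y) z *
        Real.log (signMix t (mom w x s 1 y) (mom w x s (x k) y) z) ∂(gaussianReal 0 1)
        ∂(gaussPi K) := by
  have hc : ∀ j, (fun j => if j = k then (0 : ℝ) else 1) j ^ 2 ≤ 1 := fun j => by
    by_cases h : j = k <;> simp [h]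
  have hi := integrable_mom_log hw x (Function.update s k t)
  have h1 := (integrable_mix hc hi).integral_prod_left
  have h2 := integral_mix hc hi
  have h3 : ∀ y : K → ℝ, ∫ z : K → ℝ, signMix t (mom w x s 1 y) (mom w x s (x k) y) (z k) *
        Real.log (signMix t (mom w x s 1 y) (mom w x s (x k) y) (z k)) ∂(gaussPi K) =
      ∫ z, signMix t (mom w x s 1 y) (mom w x s (x k) y) z *
        Real.log (signMix t (mom w x s 1 y) (mom w x s (x k) y) z) ∂(gaussianReal 0 1) :=
    fun y => integral_comp_eval (μ := fun _ : K => gaussianReal 0 1) (i := k)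
      (f := fun z => signMix t (mom w x s 1 y) (mom w x s (x k) y) z *
        Real.log (signMix t (mom w x s 1 y) (mom w x s (x k) y) z))
      (Measurable.aestronglyMeasurable (by fun_prop))
  simp only [mom_update hk t hx w, h3] at h1 h2
  exact ⟨h1, h2⟩

theorem le_ent_update {s : K → ℝ} {k : K} (hk : s k = 0) {t : ℝ} (ht : 0 ≤ t) :
    ent w x s + t / 2 * ovl w x s (x k) ≤ ent w x (Function.update s k t) := by
  obtain ⟨h1, h2⟩ := ent_update hw hx hk t
  have hg := abs_sign_le hx k
  have i1 := integrable_mom_log hw x s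
  have i2 := (integrable_mom_sq_div hw hg x s).const_mul (t / 2)
  rw [h2, ent, ovl, ← integral_const_mul, ← integral_add i1 i2]
  exact integral_mono (i1.add i2) h1 fun y =>
    le_integral_signMix_log ht (mom_one_pos hw x s y) (abs_mom_le hw hg x s y)

theorem ent_update_le {s : K → ℝ} (hs : ∀ k, 0 ≤ s k) {k : K} (hk : s k = 0) {t : ℝ}
    (ht : 0 ≤ t) :
    ent w x (Function.update s k t) ≤ ent w x s +
      (Real.sinh t * ovl w x s (x k) + (∑ θ, w θ) * (Real.cosh t - 1)) := by
  obtain ⟨h1, h2⟩ := ent_update hw hx hk t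
  have hg := abs_sign_le hx k
  have i1 := integrable_mom_log hw x s
  have i2 := (integrable_mom_sq_div hw hg x s).const_mul (Real.sinh t)
  have i3 := (integrable_mom w x s 1).mul_const (Real.cosh t - 1)
  have i23 : Integrable (fun y => Real.sinh t * (mom w x s (x k) y ^ 2 / mom w x s 1 y) +
    mom w x s 1 y * (Real.cosh t - 1)) (gaussPi K) := i2.add i3
  have hW := integral_mom hx hs w 1
  simp only [Pi.one_apply, mul_one] at hW
  rw [h2, ent, ovl, ← hW, ← integral_const_mul, ← integral_mul_const, ← integral_add i2 i3,
    ← integral_add i1 i23]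
  exact integral_mono h1 (i1.add i23) fun y =>
    integral_signMix_log_le ht (mom_one_pos hw x s y) (abs_mom_le hw hg x s y)

/-- The entropy gained by opening all channels in `S`, bounded from below. -/
theorem le_ent_opened {s : K → ℝ} (hs : ∀ k, 0 ≤ s k) {t : ℝ} (ht : 0 ≤ t) (S : Finset K)
    (hS : ∀ k ∈ S, s k = 0) :
    ent w x s + t / 2 * ∑ k ∈ S, ovl w x s (x k) ≤ ent w x (opened s S t) := by
  induction S using Finset.induction_on with
  | empty => simp [opened_empty]
  | insert k S hk ih =>
    have hS' : ∀ j ∈ S, s j = 0 := fun j hj => hS j (Finset.mem_insert_of_mem hj)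
    have h0 : opened s S t k = 0 := by
      rw [opened_apply_of_notMem hk, hS k (Finset.mem_insert_self k S)]
    have h1 := le_ent_update hw hx h0 ht
    -- The increment involves the overlap given the channels already opened, which dominates the
    -- overlap given `s` alone.
    have h2 := ovl_mono hw hx hs (le_opened hS' ht) (abs_sign_le hx k)
    rw [opened_insert, Finset.sum_insert hk]
    linarith [ih hS', mul_le_mul_of_nonneg_left h2 (show 0 ≤ t / 2 by linarith)]

/-- The entropy gained by opening all channels in `S`, bounded from above. -/
theorem ent_opened_le {s : K → ℝ} (hs : ∀ k, 0 ≤ s k) {t : ℝ} (ht : 0 ≤ t) (S : Finset K)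
    (hS : ∀ k ∈ S, s k = 0) :
    ent w x (opened s S t) ≤ ent w x s +
      ∑ k ∈ S, (Real.sinh t * ovl w x (opened s S t) (x k) +
        (∑ θ, w θ) * (Real.cosh t - 1)) := by
  induction S using Finset.induction_on with
  | empty => simp [opened_empty]
  | insert k S hk ih =>
    have hS' : ∀ j ∈ S, s j = 0 := fun j hj => hS j (Finset.mem_insert_of_mem hj)
    have h0 : opened s S t k = 0 := by
      rw [opened_apply_of_notMem hk, hS k (Finset.mem_insert_self k S)]
    have h1 := ent_update_le hw hx (opened_nonneg hs ht) h0 ht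
    -- All overlaps are raised to those of the configuration with `k` open too, so that the final
    -- bound involves only the final configuration.
    have h2 : ∀ i, Real.sinh t * ovl w x (opened s S t) (x i) ≤
        Real.sinh t * ovl w x (opened s (insert k S) t) (x i) := fun i => by
      refine mul_le_mul_of_nonneg_left
        (ovl_mono hw hx (opened_nonneg hs ht) (fun j => ?_) (abs_sign_le hx i))
        (Real.sinh_nonneg_iff.2 ht)
      rw [opened_insert]
      rcases eq_or_ne j k with rfl | hj
      · simpa [h0] using ht
      · simp [hj]
    have h3 := Finset.sum_le_sum fun i (_ : i ∈ S) =>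
      add_le_add_left (h2 i) ((∑ θ, w θ) * (Real.cosh t - 1))
    rw [← opened_insert] at h1
    rw [Finset.sum_insert hk]
    linarith [ih hS', h2 k]

end

/-! ### Comparison of two families of channels. -/

noncomputable section

section SumChannels

variable {K₁ K₂ Θ : Type*} [Fintype K₁] [Fintype K₂] [Fintype Θ]

theorem measurePreserving_comp_inl :
    MeasurePreserving (fun (y : K₁ ⊕ K₂ → ℝ) k => y (.inl k))
      (gaussPi (K₁ ⊕ K₂)) (gaussPi K₁) :=
  measurePreserving_fst.comp
    (measurePreserving_sumPiEquivProdPi fun _ : K₁ ⊕ K₂ => gaussianReal 0 1)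

theorem measurePreserving_comp_inr :
    MeasurePreserving (fun (y : K₁ ⊕ K₂ → ℝ) k => y (.inr k))
      (gaussPi (K₁ ⊕ K₂)) (gaussPi K₂) :=
  measurePreserving_snd.comp
    (measurePreserving_sumPiEquivProdPi fun _ : K₁ ⊕ K₂ => gaussianReal 0 1)

/-- Channels at ratio `0` output pure noise and integrate out. -/
theorem ovl_sum_left (w : Θ → ℝ) (x₁ : K₁ → Θ → ℝ) (x₂ : K₂ → Θ → ℝ) (s : K₁ → ℝ) (g : Θ → ℝ) :
    ovl w (Sum.elim x₁ x₂) (Sum.elim s 0) g = ovl w x₁ s g := by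
  have h : ∀ g, mom w (Sum.elim x₁ x₂) (Sum.elim s 0) g =
      fun y => mom w x₁ s g (fun k => y (.inl k)) := fun g => by
    funext y; simp [mom, lik, kern_zero]
  simp only [ovl, h]
  rw [← (measurePreserving_comp_inl (K₁ := K₁) (K₂ := K₂)).map_eq]
  exact (integral_map (f := fun y => mom w x₁ s g y ^ 2 / mom w x₁ s 1 y)
    measurePreserving_comp_inl.measurable.aemeasurable
    (Measurable.aestronglyMeasurable (by fun_prop))).symm

theorem ovl_sum_right (w : Θ → ℝ) (x₁ : K₁ → Θ → ℝ) (x₂ : K₂ → Θ → ℝ) (s : K₂ → ℝ)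
    (g : Θ → ℝ) : ovl w (Sum.elim x₁ x₂) (Sum.elim 0 s) g = ovl w x₂ s g := by
  have h : ∀ g, mom w (Sum.elim x₁ x₂) (Sum.elim 0 s) g =
      fun y => mom w x₂ s g (fun k => y (.inr k)) := fun g => by
    funext y; simp [mom, lik, kern_zero]
  simp only [ovl, h]
  rw [← (measurePreserving_comp_inr (K₁ := K₁) (K₂ := K₂)).map_eq]
  exact (integral_map (f := fun y => mom w x₂ s g y ^ 2 / mom w x₂ s 1 y)
    measurePreserving_comp_inr.measurable.aemeasurable
    (Measurable.aestronglyMeasurable (by fun_prop))).symm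

/-- Comparison of the overlaps given two different families of channels: the second family cannot
gain much more entropy after the first family has been observed. -/
theorem sum_ovl_le [Nonempty Θ] {w : Θ → ℝ} (hw : ∀ θ, 0 < w θ) {x₁ : K₁ → Θ → ℝ}
    {x₂ : K₂ → Θ → ℝ} (hx₁ : ∀ k θ, x₁ k θ ^ 2 = 1) (hx₂ : ∀ k θ, x₂ k θ ^ 2 = 1)
    {t₁ t₂ : ℝ} (ht₁ : 0 ≤ t₁) (ht₂ : 0 ≤ t₂) :
    t₂ / 2 * ∑ k, ovl w x₁ (fun _ => t₁) (x₂ k) ≤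
      Fintype.card K₁ * ((∑ θ, w θ) * (Real.exp t₁ - 1)) +
      ∑ k, (Real.sinh t₂ * ovl w x₂ (fun _ => t₂) (x₂ k) +
        (∑ θ, w θ) * (Real.cosh t₂ - 1)) := by
  classical
  set x : K₁ ⊕ K₂ → Θ → ℝ := Sum.elim x₁ x₂ with hx_def
  have hx : ∀ k θ, x k θ ^ 2 = 1 := by
    rintro (k | k) θ
    exacts [hx₁ k θ, hx₂ k θ]
  set S₁ : Finset (K₁ ⊕ K₂) := Finset.univ.map Function.Embedding.inl with hS₁
  set S₂ : Finset (K₁ ⊕ K₂) := Finset.univ.map Function.Embedding.inr with hS₂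
  have hX : opened 0 S₁ t₁ = (Sum.elim (fun _ => t₁) 0 : K₁ ⊕ K₂ → ℝ) := by
    funext k; rcases k with k | k <;> simp [opened, hS₁]
  have hG : opened 0 S₂ t₂ = (Sum.elim 0 (fun _ => t₂) : K₁ ⊕ K₂ → ℝ) := by
    funext k; rcases k with k | k <;> simp [opened, hS₂]
  have hXG : opened (opened 0 S₂ t₂) S₁ t₁ = opened (opened 0 S₁ t₁) S₂ t₂ := by
    funext k; rcases k with k | k <;> simp [opened, hS₁, hS₂]
  have h0 : ∀ k : K₁ ⊕ K₂, (0 : ℝ) ≤ (0 : K₁ ⊕ K₂ → ℝ) k := fun _ => le_rfl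
  have hX0 : ∀ k ∈ S₂, opened 0 S₁ t₁ k = 0 := by
    intro k hk
    obtain ⟨j, -, rfl⟩ := Finset.mem_map.1 hk
    rw [hX]; rfl
  have hG0 : ∀ k ∈ S₁, opened 0 S₂ t₂ k = 0 := by
    intro k hk
    obtain ⟨j, -, rfl⟩ := Finset.mem_map.1 hk
    rw [hG]; rfl
  -- The entropy with both families open is bounded below by opening `S₁` and then `S₂` (`e4`,
  -- `e1`), and above by opening `S₂` and then `S₁` (`e3`, `e2`).
  have e1 := le_ent_opened hw hx (opened_nonneg h0 ht₁) ht₂ S₂ hX0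
  have e2 := ent_opened_le hw hx (opened_nonneg h0 ht₂) ht₁ S₁ hG0
  have e3 := ent_opened_le hw hx h0 ht₂ S₂ fun _ _ => rfl
  have e4 := le_ent_opened hw hx h0 ht₁ S₁ fun _ _ => rfl
  have e5 : 0 ≤ t₁ / 2 * ∑ k ∈ S₁, ovl w x 0 (x k) :=
    mul_nonneg (by linarith) (Finset.sum_nonneg fun k _ => ovl_nonneg hw _ _ _)
  -- For the first family the trivial bound of each overlap by the total weight is enough, and `sinh
  -- + cosh = exp`.
  have e6 : ∑ k ∈ S₁, (Real.sinh t₁ * ovl w x (opened (opened 0 S₂ t₂) S₁ t₁) (x k) +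
      (∑ θ, w θ) * (Real.cosh t₁ - 1)) ≤
      Fintype.card K₁ * ((∑ θ, w θ) * (Real.exp t₁ - 1)) := by
    have hc : S₁.card = Fintype.card K₁ := by rw [hS₁, Finset.card_map, Finset.card_univ]
    rw [← hc, ← nsmul_eq_mul]
    refine Finset.sum_le_card_nsmul _ _ _ fun k _ => ?_
    have := mul_le_mul_of_nonneg_left (ovl_le hw hx
      (opened_nonneg (opened_nonneg h0 ht₂) ht₁) (abs_sign_le hx k) (s := opened (opened 0 S₂ t₂) S₁ t₁))
      (Real.sinh_nonneg_iff.2 ht₁)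
    rw [← Real.cosh_add_sinh]
    linarith
  have e7 : ∑ k ∈ S₂, ovl w x (opened 0 S₁ t₁) (x k) =
      ∑ k, ovl w x₁ (fun _ => t₁) (x₂ k) := by
    rw [hS₂, Finset.sum_map, hX]
    exact Finset.sum_congr rfl fun k _ => ovl_sum_left w x₁ x₂ _ _
  have e8 : ∑ k ∈ S₂, (Real.sinh t₂ * ovl w x (opened 0 S₂ t₂) (x k) +
        (∑ θ, w θ) * (Real.cosh t₂ - 1)) =
      ∑ k, (Real.sinh t₂ * ovl w x₂ (fun _ => t₂) (x₂ k) +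
        (∑ θ, w θ) * (Real.cosh t₂ - 1)) := by
    conv_lhs => rw [hS₂, Finset.sum_map, ← hS₂, hG]
    exact Finset.sum_congr rfl fun k _ => by
      rw [← ovl_sum_right w x₁ x₂ (fun _ => t₂) (x₂ k)]; rfl
  rw [hXG] at e2 e6
  rw [e7] at e1
  rw [e8] at e3
  linarith

end SumChannels

end

/-! ### The lattice model in terms of posterior moments. -/

noncomputable section

theorem signVal_sq (s : ℤˣ) : signVal s ^ 2 = 1 := by
  rcases Int.units_eq_one_or s with rfl | rfl <;> simp [signVal]

theorem signVal_mul (s t : ℤˣ) : signVal (s * t) = signVal s * signVal t := by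
  simp [signVal]

theorem abs_signVal (s : ℤˣ) : |signVal s| = 1 := by
  rcases Int.units_eq_one_or s with rfl | rfl <;> simp [signVal]

theorem isProbabilityMeasure_signLaw {m : ℝ} (h1 : -1 ≤ m) (h2 : m ≤ 1) :
    IsProbabilityMeasure (signLaw m) := by
  refine ⟨?_⟩
  simp only [signLaw, Measure.add_apply, Measure.smul_apply, measure_univ, smul_eq_mul, mul_one]
  rw [← ENNReal.ofReal_add (by linarith) (by linarith)]
  ring_nf
  simp

theorem signLaw_singleton_pos {m : ℝ} (h1 : -1 < m) (h2 : m < 1) (s : ℤˣ) :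
    0 < signLaw m {s} := by
  rcases Int.units_eq_one_or s with rfl | rfl
  · have : 0 < ENNReal.ofReal ((1 + m) / 2) := ENNReal.ofReal_pos.2 (by linarith)
    refine this.trans_le ?_
    simp [signLaw]
  · have : 0 < ENNReal.ofReal ((1 - m) / 2) := ENNReal.ofReal_pos.2 (by linarith)
    refine this.trans_le ?_
    simp [signLaw]

variable {d n L : ℕ}

/-- The true signs of the edges. -/
def edgeSpin (θ : Box d n → ℤˣ) : Edge d n → ℤˣ := fun e => pairSpin θ e.1

/-- The input of the channel at a pair in range. -/
def chanIn (d n L : ℕ) (e : RangePair d n L) (θ : Box d n → ℤˣ) : ℝ := signVal (pairSpin θ e.1)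

/-- The probability that the spins are `θ` and the observations on the edges are `b`. -/
def latWeight (d n : ℕ) (δ : ℝ) (b : Edge d n → ℤˣ) (θ : Box d n → ℤˣ) : ℝ :=
  (Measure.pi fun _ : Box d n => signLaw 0).real {θ} *
    (Measure.pi fun _ : Edge d n => signLaw δ).real {b * edgeSpin θ}

/-- The product of two spins. -/
def spinProd (u v : Box d n) (θ : Box d n → ℤˣ) : ℝ := signVal (θ u) * signVal (θ v)

theorem chanIn_sq (e : RangePair d n L) (θ : Box d n → ℤˣ) : chanIn d n L e θ ^ 2 = 1 :=
  signVal_sq _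

theorem abs_spinProd (u v : Box d n) (θ : Box d n → ℤˣ) : |spinProd u v θ| = 1 := by
  rw [spinProd, abs_mul, abs_signVal, abs_signVal, mul_one]

theorem edgeSpin_mul_self (θ : Box d n → ℤˣ) : edgeSpin θ * edgeSpin θ = 1 := by
  funext e; exact Int.units_mul_self _

theorem latWeight_pos {δ : ℝ} (h0 : 0 < δ) (h1 : δ < 1) (b : Edge d n → ℤˣ)
    (θ : Box d n → ℤˣ) : 0 < latWeight d n δ b θ := by
  have := isProbabilityMeasure_signLaw (m := 0) (by norm_num) (by norm_num)
  have := isProbabilityMeasure_signLaw (m := δ) (by linarith) h1.le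
  refine mul_pos ?_ ?_ <;> rw [measureReal_def, Measure.pi_singleton] <;>
    refine ENNReal.toReal_pos (Finset.prod_ne_zero_iff.2 fun i _ => ?_)
      (ENNReal.prod_ne_top fun i _ => measure_ne_top _ _)
  · exact (signLaw_singleton_pos (by norm_num) (by norm_num) _).ne'
  · exact (signLaw_singleton_pos (by linarith) h1 _).ne'

theorem isProbabilityMeasure_sampleLaw (d n L : ℕ) {δ : ℝ} (h0 : 0 < δ) (h1 : δ < 1) :
    IsProbabilityMeasure (sampleLaw d n L δ) := by
  have := isProbabilityMeasure_signLaw (m := 0) (by norm_num) (by norm_num)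
  have := isProbabilityMeasure_signLaw (m := δ) (by linarith) h1.le
  unfold sampleLaw
  infer_instance

/-- Spins and edge signs take finitely many values, so measurability is only at stake in the
Gaussian coordinates. -/
theorem measurable_observe_comp {E : Type*} [MeasurableSpace E]
    {H : (Box d n → ℤˣ) → Obs d n L → E} (hH : ∀ θ, Measurable (H θ)) (η : ℝ) :
    Measurable fun ω : Sample d n L => H ω.1 (observe d n L η ω) := by
  refine measurable_from_prod_countable_right fun θ => ?_
  refine measurable_from_prod_countable_right fun ξ => ?_
  refine (hH θ).comp ?_
  refine Measurable.prodMk (measurable_const (a := ξ * edgeSpin θ))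
    (measurable_pi_iff.2 fun e => ?_)
  exact Measurable.const_add (f := fun z : RangePair d n L → ℝ => z e)
    (measurable_pi_apply e) (Real.sqrt (η / (L : ℝ) ^ d) * signVal (pairSpin θ e.1))

theorem measurable_observe (η : ℝ) : Measurable (observe d n L η) :=
  measurable_observe_comp (H := fun _ o => o) (fun _ => measurable_id) η

/-- Expectations of functions of the spins and the observations. -/
theorem integral_sampleLaw {δ η : ℝ} (h0 : 0 < δ) (h1 : δ < 1) (hη : 0 ≤ η)
    {H : (Box d n → ℤˣ) → Obs d n L → ℝ} (hH : ∀ θ, Measurable (H θ))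
    {C : ℝ} (hC : ∀ θ o, |H θ o| ≤ C) :
    ∫ ω, H ω.1 (observe d n L η ω) ∂(sampleLaw d n L δ) =
      ∑ b, ∫ y, ∑ θ, latWeight d n δ b θ *
        lik (chanIn d n L) (fun _ => η / (L : ℝ) ^ d) θ y * H θ (b, y)
          ∂(gaussPi (RangePair d n L)) := by
  have i1 := isProbabilityMeasure_signLaw (m := 0) (by norm_num) (by norm_num)
  have i2 := isProbabilityMeasure_signLaw (m := δ) (by linarith) h1.le
  have hs : ∀ _ : RangePair d n L, 0 ≤ η / (L : ℝ) ^ d := fun _ => by positivity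
  have hint : Integrable (fun ω : Sample d n L => H ω.1 (observe d n L η ω))
      (sampleLaw d n L δ) := by
    have := isProbabilityMeasure_sampleLaw d n L h0 h1
    exact Integrable.of_bound (measurable_observe_comp hH η).aestronglyMeasurable C
      (ae_of_all _ fun ω => hC _ _)
  have hlik : ∀ b θ, Integrable (fun y => latWeight d n δ b θ *
        lik (chanIn d n L) (fun _ => η / (L : ℝ) ^ d) θ y * H θ (b, y))
          (gaussPi (RangePair d n L)) := fun b θ => by
    refine ((integrable_lik _ _ _).const_mul _).mul_bdd (c := C) ?_ (ae_of_all _ fun y => hC _ _)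
    exact ((hH θ).comp measurable_prodMk_left).aestronglyMeasurable
  simp_rw [integral_finsetSum Finset.univ fun θ _ => hlik _ θ]
  rw [Finset.sum_comm, sampleLaw, integral_prod _ hint, integral_fintype .of_finite]
  refine Finset.sum_congr rfl fun θ _ => ?_
  have hm : Measurable fun p : (Edge d n → ℤˣ) × (RangePair d n L → ℝ) =>
      H θ (observe d n L η (θ, p)) :=
    (measurable_observe_comp hH η).comp measurable_prodMk_left
  have hint2 : Integrable (fun p : (Edge d n → ℤˣ) × (RangePair d n L → ℝ) =>
      H θ (observe d n L η (θ, p)))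
      ((Measure.pi fun _ => signLaw δ).prod (gaussPi (RangePair d n L))) :=
    Integrable.of_bound hm.aestronglyMeasurable C (ae_of_all _ fun _ => hC _ _)
  -- For fixed `θ`, the sum over noise signs is reindexed by the observed signs; multiplication by
  -- `edgeSpin θ` is an involution.
  rw [integral_prod _ hint2, integral_fintype .of_finite, smul_eq_mul, Finset.mul_sum,
    ← Equiv.sum_comp (Equiv.mulRight (edgeSpin θ))]
  refine Finset.sum_congr rfl fun b _ => ?_
  have hb : b * edgeSpin θ * edgeSpin θ = b := by
    rw [mul_assoc, edgeSpin_mul_self, mul_one]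
  have hsh := integral_shift_gaussPi hs (fun e : RangePair d n L => chanIn_sq e θ)
    (H := fun y => H θ (b, y)) ((hH θ).comp measurable_prodMk_left)
  simp only [Equiv.coe_mulRight, smul_eq_mul, latWeight]
  simp_rw [mul_assoc]
  rw [integral_const_mul, integral_const_mul]
  congr 2
  refine Eq.trans ?_ hsh
  refine integral_congr_ae (ae_of_all _ fun z => ?_)
  simp only [observe]
  congr 2

/-- The average over pairs of vertices of the second moment of the posterior expectation of the
product of the spins. -/
def meanOvl (d n L : ℕ) (δ η : ℝ) : ℝ :=
  1 / (Fintype.card (Box d n) : ℝ) ^ 2 * ∑ u, ∑ v, ∑ b,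
    ovl (latWeight d n δ b) (chanIn d n L) (fun _ => η / (L : ℝ) ^ d) (spinProd u v)

/-- The posterior expectation of `g`. -/
def postMean (d n L : ℕ) (δ η : ℝ) (g : (Box d n → ℤˣ) → ℝ) (o : Obs d n L) : ℝ :=
  mom (latWeight d n δ o.1) (chanIn d n L) (fun _ => η / (L : ℝ) ^ d) g o.2 /
    mom (latWeight d n δ o.1) (chanIn d n L) (fun _ => η / (L : ℝ) ^ d) 1 o.2

theorem measurable_postMean (δ η : ℝ) (g : (Box d n → ℤˣ) → ℝ) :
    Measurable (postMean d n L δ η g) :=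
  measurable_from_prod_countable_right fun b =>
    (measurable_mom (latWeight d n δ b) _ _ g).div (measurable_mom (latWeight d n δ b) _ _ 1)

section

variable {δ η : ℝ} (h0 : 0 < δ) (h1 : δ < 1)
include h0 h1

theorem abs_postMean_le {g : (Box d n → ℤˣ) → ℝ} (hg : ∀ θ, |g θ| ≤ 1) (o : Obs d n L) :
    |postMean d n L δ η g o| ≤ 1 := by
  have h := mom_one_pos (latWeight_pos h0 h1 o.1) (chanIn d n L)
    (fun _ => η / (L : ℝ) ^ d) o.2
  rw [postMean, abs_div, abs_of_pos h, div_le_one h]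
  exact abs_mom_le (latWeight_pos h0 h1 o.1) hg _ _ _

/-- Bayes' formula, checked on each event that the observation lies in `A`: the normalization `mom …
1` cancels after summation over `θ`. -/
theorem condExp_eq_postMean (hη : 0 ≤ η) {g : (Box d n → ℤˣ) → ℝ} (hg : ∀ θ, |g θ| ≤ 1) :
    (fun ω => postMean d n L δ η g (observe d n L η ω)) =ᵐ[sampleLaw d n L δ]
      (sampleLaw d n L δ)[fun ω => g ω.1 |
        MeasurableSpace.comap (observe d n L η) inferInstance] := by
  have := isProbabilityMeasure_sampleLaw d n L h0 h1
  have hgm : Measurable fun ω : Sample d n L => g ω.1 :=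
    (measurable_of_countable g).comp measurable_fst
  have hpm : Measurable fun ω : Sample d n L => postMean d n L δ η g (observe d n L η ω) :=
    (measurable_postMean δ η g).comp (measurable_observe η)
  refine ae_eq_condExp_of_forall_setIntegral_eq (measurable_observe η).comap_le
    (Integrable.of_bound hgm.aestronglyMeasurable 1 (ae_of_all _ fun ω => hg _))
    (fun _ _ _ => (Integrable.of_bound hpm.aestronglyMeasurable 1
      (ae_of_all _ fun ω => abs_postMean_le h0 h1 hg _)).integrableOn) ?_
    ((measurable_postMean δ η g).comp
      (comap_measurable (observe d n L η))).stronglyMeasurable.aestronglyMeasurable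
  rintro _ ⟨A, hA, rfl⟩ -
  rw [← integral_indicator (measurable_observe η hA),
    ← integral_indicator (measurable_observe η hA)]
  have e1 := integral_sampleLaw (L := L) h0 h1 hη (C := 1)
    (H := fun _ => A.indicator (postMean d n L δ η g))
    (fun _ => (measurable_postMean δ η g).indicator hA) (fun θ o => by
      by_cases ho : o ∈ A
      · simpa [ho] using abs_postMean_le h0 h1 hg o
      · simp [ho])
  have e2 := integral_sampleLaw (L := L) h0 h1 hη (C := 1)
    (H := fun θ => A.indicator (fun _ => g θ))
    (fun _ => measurable_const.indicator hA) (fun θ o => by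
      by_cases ho : o ∈ A
      · simpa [ho] using hg θ
      · simp [ho])
  refine Eq.trans (Eq.trans e1 ?_) e2.symm
  refine Finset.sum_congr rfl fun b _ => integral_congr_ae (ae_of_all _ fun y => ?_)
  simp only
  by_cases ho : (b, y) ∈ A
  · simp only [Set.indicator_of_mem ho]
    have h := mom_one_pos (latWeight_pos h0 h1 b) (chanIn d n L) (fun _ => η / (L : ℝ) ^ d) y
    rw [← Finset.sum_mul, postMean]
    have e3 : ∑ θ, latWeight d n δ b θ * lik (chanIn d n L) (fun _ => η / (L : ℝ) ^ d) θ y =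
        mom (latWeight d n δ b) (chanIn d n L) (fun _ => η / (L : ℝ) ^ d) 1 y := by
      simp [mom]
    rw [e3, mul_div_cancel₀ _ h.ne']
    exact Finset.sum_congr rfl fun θ _ => by ring
  · simp [Set.indicator_of_notMem ho]

theorem integral_postMean_sq (hη : 0 ≤ η) {g : (Box d n → ℤˣ) → ℝ} (hg : ∀ θ, |g θ| ≤ 1) :
    ∫ ω, postMean d n L δ η g (observe d n L η ω) ^ 2 ∂(sampleLaw d n L δ) =
      ∑ b, ovl (latWeight d n δ b) (chanIn d n L) (fun _ => η / (L : ℝ) ^ d) g := by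
  rw [integral_sampleLaw (L := L) h0 h1 hη (C := 1)
    (H := fun _ o => postMean d n L δ η g o ^ 2)
    (fun _ => (measurable_postMean δ η g).pow_const 2) (fun θ o => by
      rw [abs_pow]; exact pow_le_one₀ (abs_nonneg _) (abs_postMean_le h0 h1 hg o))]
  refine Finset.sum_congr rfl fun b _ => integral_congr_ae (ae_of_all _ fun y => ?_)
  have h := mom_one_pos (latWeight_pos h0 h1 b) (chanIn d n L) (fun _ => η / (L : ℝ) ^ d) y
  have e3 : ∑ θ, latWeight d n δ b θ * lik (chanIn d n L) (fun _ => η / (L : ℝ) ^ d) θ y =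
      mom (latWeight d n δ b) (chanIn d n L) (fun _ => η / (L : ℝ) ^ d) 1 y := by
    simp [mom]
  simp only
  rw [← Finset.sum_mul, postMean, e3]
  field_simp

theorem pairCorr_eq_meanOvl (hη : 0 ≤ η) :
    pairCorr d n δ η = meanOvl d n (2 * n + 1) δ η := by
  unfold pairCorr meanOvl
  congr 1
  refine Finset.sum_congr rfl fun u _ => Finset.sum_congr rfl fun v _ => ?_
  have hg : ∀ θ : Box d n → ℤˣ, |spinProd u v θ| ≤ 1 := fun θ => (abs_spinProd u v θ).le
  rw [← integral_postMean_sq h0 h1 hη hg]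
  refine integral_congr_ae ?_
  filter_upwards [condExp_eq_postMean (L := 2 * n + 1) h0 h1 hη hg] with ω hω
  rw [hω]
  rfl

theorem sum_latWeight (d n : ℕ) : ∑ b, ∑ θ, latWeight d n δ b θ = 1 := by
  have := isProbabilityMeasure_sampleLaw d n 0 h0 h1
  have e := integral_sampleLaw (L := 0) (d := d) (n := n) (η := 0) h0 h1 le_rfl (C := 1)
    (H := fun _ _ => 1) (fun _ => measurable_const) (fun _ _ => by simp)
  have e2 : ∀ b, ∫ y, ∑ θ, latWeight d n δ b θ *
      lik (chanIn d n 0) (fun _ => 0 / ((0 : ℕ) : ℝ) ^ d) θ y * 1 ∂(gaussPi (RangePair d n 0)) =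
      ∑ θ, latWeight d n δ b θ := fun b => by
    have := integral_mom (chanIn_sq (d := d) (n := n) (L := 0))
      (s := fun _ => 0 / ((0 : ℕ) : ℝ) ^ d) (fun _ => by simp) (latWeight d n δ b) 1
    simpa [mom] using this
  simp_rw [e2] at e
  simpa using e.symm

/-- Given the data, a sign correlates with the target by at most the absolute posterior mean `|G| /
F`. The bound `|G| ≤ α F / 2 + G² / (2 α F)` is Cauchy-Schwarz in linear form, so it can be averaged
over vertices and observations without square roots. -/
theorem abs_integral_estimator_le (hη : 0 ≤ η) {α : ℝ} (hα : 0 < α)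
    {T : Obs d n L → ℤˣ} (hT : Measurable T) (u v : Box d n) :
    |∫ ω, signVal (T (observe d n L η ω)) * signVal (ω.1 u) * signVal (ω.1 v)
      ∂(sampleLaw d n L δ)| ≤ α / 2 + (2 * α)⁻¹ *
      ∑ b, ovl (latWeight d n δ b) (chanIn d n L) (fun _ => η / (L : ℝ) ^ d)
        (spinProd u v) := by
  have hg : ∀ θ : Box d n → ℤˣ, |spinProd u v θ| ≤ 1 := fun θ => (abs_spinProd u v θ).le
  have hTm : Measurable fun o => signVal (T o) := (measurable_of_countable signVal).comp hT
  have e := integral_sampleLaw (L := L) h0 h1 hη (C := 1)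
    (H := fun θ o => signVal (T o) * signVal (θ u) * signVal (θ v))
    (fun θ => (hTm.mul_const _).mul_const _) (fun θ o => by
      rw [abs_mul, abs_mul, abs_signVal, abs_signVal, abs_signVal]; norm_num)
  rw [e]
  set s : RangePair d n L → ℝ := fun _ => η / (L : ℝ) ^ d with hs_def
  have hs : ∀ k, 0 ≤ s k := fun k => by rw [hs_def]; positivity
  refine (Finset.abs_sum_le_sum_abs _ _).trans ?_
  have hb : ∀ b, |∫ y, ∑ θ, latWeight d n δ b θ * lik (chanIn d n L) s θ y *
      (signVal (T (b, y)) * signVal (θ u) * signVal (θ v)) ∂(gaussPi (RangePair d n L))| ≤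
      α / 2 * ∑ θ, latWeight d n δ b θ + (2 * α)⁻¹ *
        ovl (latWeight d n δ b) (chanIn d n L) s (spinProd u v) := fun b => by
    have hw := latWeight_pos (d := d) (n := n) h0 h1 b
    have hW := integral_mom (chanIn_sq (d := d) (n := n) (L := L)) hs (latWeight d n δ b) 1
    simp only [Pi.one_apply, mul_one] at hW
    have i1 := (integrable_mom (latWeight d n δ b) (chanIn d n L) s 1).const_mul (α / 2)
    have i2 := (integrable_mom_sq_div hw hg (chanIn d n L) s).const_mul (2 * α)⁻¹
    rw [← hW, ovl, ← integral_const_mul, ← integral_const_mul, ← integral_add i1 i2,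
      ← Real.norm_eq_abs]
    refine norm_integral_le_of_norm_le (i1.add i2) (ae_of_all _ fun y => ?_)
    have h := mom_one_pos hw (chanIn d n L) s y
    have e3 : ∑ θ, latWeight d n δ b θ * lik (chanIn d n L) s θ y *
        (signVal (T (b, y)) * signVal (θ u) * signVal (θ v)) =
        signVal (T (b, y)) * mom (latWeight d n δ b) (chanIn d n L) s (spinProd u v) y := by
      rw [mom, Finset.mul_sum]
      exact Finset.sum_congr rfl fun θ _ => by rw [spinProd]; ring
    rw [e3, Real.norm_eq_abs, abs_mul, abs_signVal, one_mul]
    set F := mom (latWeight d n δ b) (chanIn d n L) s 1 y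
    set G := mom (latWeight d n δ b) (chanIn d n L) s (spinProd u v) y
    have key : α / 2 * F + (2 * α)⁻¹ * (G ^ 2 / F) - |G| =
        (α * F - |G|) ^ 2 / (2 * α * F) := by
      rw [← sq_abs G]; field_simp; ring
    have : 0 ≤ (α * F - |G|) ^ 2 / (2 * α * F) := by positivity
    linarith
  refine (Finset.sum_le_sum fun b _ => hb b).trans (le_of_eq ?_)
  rw [Finset.sum_add_distrib, ← Finset.mul_sum, ← Finset.mul_sum, sum_latWeight h0 h1, mul_one]

instance Box.instNonempty (d n : ℕ) : Nonempty (Box d n) := ⟨⟨0, fun i => by simp⟩⟩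

theorem abs_risk_le (hη : 0 ≤ η) {α : ℝ} (hα : 0 < α)
    {T : Box d n → Box d n → Obs d n L → ℤˣ} (hT : ∀ u v, Measurable (T u v)) :
    |risk d n L δ η T| ≤ α / 2 + (2 * α)⁻¹ * meanOvl d n L δ η := by
  have hN : 0 < (Fintype.card (Box d n) : ℝ) := Nat.cast_pos.2 Fintype.card_pos
  have h : |∑ u, ∑ v, ∫ ω, signVal (T u v (observe d n L η ω)) * signVal (ω.1 u) *
      signVal (ω.1 v) ∂(sampleLaw d n L δ)| ≤ ∑ u, ∑ v, (α / 2 + (2 * α)⁻¹ *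
      ∑ b, ovl (latWeight d n δ b) (chanIn d n L) (fun _ => η / (L : ℝ) ^ d)
        (spinProd u v)) := by
    refine (Finset.abs_sum_le_sum_abs _ _).trans (Finset.sum_le_sum fun u _ => ?_)
    refine (Finset.abs_sum_le_sum_abs _ _).trans (Finset.sum_le_sum fun v _ => ?_)
    exact abs_integral_estimator_le h0 h1 hη hα (hT u v) u v
  rw [risk, abs_mul, abs_of_pos (by positivity), meanOvl]
  refine (mul_le_mul_of_nonneg_left h (by positivity)).trans (le_of_eq ?_)
  simp only [Finset.sum_add_distrib, ← Finset.mul_sum, Finset.sum_const, Finset.card_univ,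
    nsmul_eq_mul]
  field_simp

theorem meanOvl_mono (d n L : ℕ) {η' : ℝ} (hη : 0 ≤ η) (h : η ≤ η') :
    meanOvl d n L δ η ≤ meanOvl d n L δ η' := by
  unfold meanOvl
  refine mul_le_mul_of_nonneg_left ?_ (by positivity)
  refine Finset.sum_le_sum fun u _ => Finset.sum_le_sum fun v _ => Finset.sum_le_sum fun b _ => ?_
  refine ovl_mono (latWeight_pos h0 h1 b) chanIn_sq (fun _ => by positivity) (fun _ => ?_)
    (fun θ => (abs_spinProd u v θ).le)
  gcongr

theorem meanOvl_nonneg (d n L : ℕ) (η : ℝ) : 0 ≤ meanOvl d n L δ η :=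
  mul_nonneg (by positivity) <| Finset.sum_nonneg fun _ _ => Finset.sum_nonneg fun _ _ =>
    Finset.sum_nonneg fun b _ => ovl_nonneg (latWeight_pos h0 h1 b) _ _ _

end

end

/-! ### Counting pairs and the comparison of ranges. -/

noncomputable section

theorem card_box (d n : ℕ) : Fintype.card (Box d n) = (2 * n + 1) ^ d := by
  have h1 : Nat.card {b : ℤ // |b| ≤ (n : ℤ)} = 2 * n + 1 := by
    rw [Nat.card_congr (Equiv.subtypeEquivRight fun b => (abs_le (a := b) (b := (n : ℤ))))]
    have : Nat.card (Set.Icc (-(n : ℤ)) n) = 2 * n + 1 := by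
      rw [Nat.card_eq_fintype_card, Fintype.card_ofFinset, Int.card_Icc]
      omega
    exact this
  rw [← Nat.card_eq_fintype_card,
    Nat.card_congr (Equiv.subtypePiEquivPi (p := fun (_ : Fin d) (b : ℤ) => |b| ≤ (n : ℤ))),
    Nat.card_pi]
  simp [h1]

variable {d n : ℕ}

/-- A choice of an ordered representative. -/
def RangePair.rep {L : ℕ} (e : RangePair d n L) : Box d n × Box d n := Quot.out e.1

theorem RangePair.mk_rep {L : ℕ} (e : RangePair d n L) : s(e.rep.1, e.rep.2) = e.1 :=
  Quot.out_eq e.1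

theorem RangePair.near_rep {L : ℕ} (e : RangePair d n L) : Box.Near L e.rep.1 e.rep.2 := by
  have h := e.2
  rwa [← e.mk_rep, Sym2.fromRel_prop] at h

theorem RangePair.rep_injective {L : ℕ} :
    Function.Injective (RangePair.rep : RangePair d n L → Box d n × Box d n) := fun e f h => by
  rw [Subtype.ext_iff, ← e.mk_rep, ← f.mk_rep, h]

/-- A pair is encoded by one endpoint and the displacement, which lies in a box of radius `L`. -/
theorem card_rangePair_le (d n L : ℕ) :
    Fintype.card (RangePair d n L) ≤ Fintype.card (Box d n) * (2 * L + 1) ^ d := by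
  rw [← card_box d L, ← Fintype.card_prod]
  refine Fintype.card_le_of_injective
    (fun e => (e.rep.1, (⟨fun i => e.rep.1.1 i - e.rep.2.1 i, e.near_rep⟩ : Box d L)))
    fun e f h => RangePair.rep_injective ?_
  simp only [Prod.mk.injEq] at h
  refine Prod.ext h.1 (Subtype.ext (funext fun i => ?_))
  have h2 := congrFun (Subtype.ext_iff.1 h.2) i
  simp only [h.1] at h2
  linarith

theorem near_full (u v : Box d n) : Box.Near (2 * n + 1) u v := fun i => by
  have h1 := abs_le.1 (u.2 i)
  have h2 := abs_le.1 (v.2 i)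
  rw [abs_le]
  push_cast
  constructor <;> linarith

/-- Any two vertices of the box, as an unordered pair in range. -/
def fullPair (p : Box d n × Box d n) : RangePair d n (2 * n + 1) :=
  ⟨s(p.1, p.2), by rw [Sym2.fromRel_prop]; exact near_full p.1 p.2⟩

theorem fullPair_rep (e : RangePair d n (2 * n + 1)) : fullPair e.rep = e :=
  Subtype.ext e.mk_rep

theorem chanIn_fullPair (u v : Box d n) :
    chanIn d n (2 * n + 1) (fullPair (u, v)) = spinProd u v := by
  funext θ; exact signVal_mul _ _

theorem sum_rangePair_le {F : RangePair d n (2 * n + 1) → ℝ} (hF : ∀ e, 0 ≤ F e) :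
    ∑ e, F e ≤ ∑ u, ∑ v, F (fullPair (u, v)) := by
  rw [← Fintype.sum_prod_type']
  calc ∑ e, F e = ∑ p ∈ Finset.univ.map ⟨_, RangePair.rep_injective⟩, F (fullPair p) := by
        rw [Finset.sum_map]
        exact Finset.sum_congr rfl fun e _ => by
          rw [Function.Embedding.coeFn_mk, fullPair_rep]
    _ ≤ ∑ p, F (fullPair p) :=
        Finset.sum_le_sum_of_subset_of_nonneg (Finset.subset_univ _) fun _ _ _ => hF _

/-- An unordered pair has at most two orderings. -/
theorem le_sum_rangePair {F : RangePair d n (2 * n + 1) → ℝ} (hF : ∀ e, 0 ≤ F e) :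
    ∑ u, ∑ v, F (fullPair (u, v)) ≤ 2 * ∑ e, F e := by
  classical
  rw [← Fintype.sum_prod_type', ← Finset.sum_fiberwise Finset.univ fullPair, Finset.mul_sum]
  refine Finset.sum_le_sum fun e _ => ?_
  have hsub : Finset.univ.filter (fun p : Box d n × Box d n => fullPair p = e) ⊆
      {e.rep, e.rep.swap} := by
    intro p hp
    have hp := congrArg Subtype.val (Finset.mem_filter.1 hp).2
    rw [← e.mk_rep] at hp
    rcases Sym2.eq_iff.1 hp with ⟨h1, h2⟩ | ⟨h1, h2⟩
    · exact Finset.mem_insert.2 (Or.inl (Prod.ext h1 h2))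
    · exact Finset.mem_insert_of_mem (Finset.mem_singleton.2 (Prod.ext h1 h2))
  have hcard : ((Finset.univ.filter
      fun p : Box d n × Box d n => fullPair p = e).card : ℝ) ≤ 2 := by
    exact_mod_cast (Finset.card_le_card hsub).trans Finset.card_le_two
  calc ∑ p with fullPair p = e, F (fullPair p) = ∑ p with fullPair p = e, F e :=
        Finset.sum_congr rfl fun p hp => by rw [(Finset.mem_filter.1 hp).2]
    _ ≤ 2 * F e := by
        rw [Finset.sum_const, nsmul_eq_mul]
        exact mul_le_mul_of_nonneg_right hcard (hF e)

theorem sinh_le_two_mul {t : ℝ} (h0 : 0 ≤ t) (h1 : t ≤ 1) : Real.sinh t ≤ 2 * t := by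
  have e1 := (abs_le.1 (Real.abs_exp_sub_one_le (x := t) (by rwa [abs_of_nonneg h0]))).2
  have e2 := (abs_le.1 (Real.abs_exp_sub_one_le (x := -t) (by rwa [abs_neg, abs_of_nonneg h0]))).1
  rw [abs_neg, abs_of_nonneg h0] at e2
  rw [abs_of_nonneg h0] at e1
  rw [Real.sinh_eq]
  linarith

theorem cosh_sub_one_le_sq {t : ℝ} (h0 : 0 ≤ t) (h1 : t ≤ 1) : Real.cosh t - 1 ≤ t ^ 2 := by
  have e1 := (abs_le.1 (Real.abs_exp_sub_one_sub_id_le (x := t) (by rwa [abs_of_nonneg h0]))).2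
  have e2 := (abs_le.1 (Real.abs_exp_sub_one_sub_id_le (x := -t)
    (by rwa [abs_neg, abs_of_nonneg h0]))).2
  rw [Real.cosh_eq]
  linarith [neg_sq t]

/-- Side information of range `L` and small strength `η` hardly increases the pair correlation
above the one with full-range side information of strength `l`. -/
theorem meanOvl_le {δ : ℝ} (h0 : 0 < δ) (h1 : δ < 1) (d n : ℕ) {L : ℕ} (hL : 1 ≤ L) {η l : ℝ}
    (hη : 0 ≤ η) (hη1 : η ≤ 1) (hl : 0 < l) (hlN : l ≤ Fintype.card (Box d n)) :
    meanOvl d n L δ η ≤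
      8 * 3 ^ d * η / l + 8 * pairCorr d n δ l + 4 * l / Fintype.card (Box d n) := by
  have hN : 0 < (Fintype.card (Box d n) : ℝ) := Nat.cast_pos.2 Fintype.card_pos
  -- With range `2n + 1` instead of `2n`, the normalization of the full-range channels is exactly
  -- the number of vertices.
  have hcN : ((2 * n + 1 : ℕ) : ℝ) ^ d = Fintype.card (Box d n) := by
    rw [card_box]; push_cast; rfl
  rw [pairCorr_eq_meanOvl h0 h1 hl.le]
  unfold meanOvl
  rw [hcN]
  set N : ℝ := (Fintype.card (Box d n) : ℝ) with hN_def
  set t := l / N with ht_def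
  have ht : 0 < t := div_pos hl hN
  have ht1 : t ≤ 1 := (div_le_one hN).2 hlN
  have hLp : (0 : ℝ) < (L : ℝ) ^ d := by
    have : (0 : ℝ) < L := by exact_mod_cast hL
    positivity
  have hL1 : (1 : ℝ) ≤ (L : ℝ) ^ d := one_le_pow₀ (by exact_mod_cast hL)
  set r := η / (L : ℝ) ^ d with hr_def
  have hr : 0 ≤ r := div_nonneg hη hLp.le
  have hr1 : r ≤ 1 := div_le_one_of_le₀ (hη1.trans hL1) hLp.le
  set A : RangePair d n (2 * n + 1) → ℝ := fun k => ∑ b,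
    ovl (latWeight d n δ b) (chanIn d n L) (fun _ => r) (chanIn d n (2 * n + 1) k) with hA
  set B : RangePair d n (2 * n + 1) → ℝ := fun k => ∑ b,
    ovl (latWeight d n δ b) (chanIn d n (2 * n + 1)) (fun _ => t)
      (chanIn d n (2 * n + 1) k) with hB
  have hA0 : ∀ k, 0 ≤ A k := fun k =>
    Finset.sum_nonneg fun b _ => ovl_nonneg (latWeight_pos h0 h1 b) _ _ _
  have hB0 : ∀ k, 0 ≤ B k := fun k =>
    Finset.sum_nonneg fun b _ => ovl_nonneg (latWeight_pos h0 h1 b) _ _ _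
  have hAs := le_sum_rangePair hA0
  have hBs := sum_rangePair_le hB0
  simp only [hA, chanIn_fullPair] at hAs
  simp only [hB, chanIn_fullPair] at hBs
  -- The comparison is applied for each frozen edge observation `b` and summed; the weights have
  -- total mass `1`.
  have hcmp := Finset.sum_le_sum fun b (_ : b ∈ Finset.univ) =>
    sum_ovl_le (latWeight_pos (d := d) (n := n) h0 h1 b) (chanIn_sq (d := d) (n := n) (L := L))
      (chanIn_sq (d := d) (n := n) (L := 2 * n + 1)) hr ht.le
  simp only [Finset.sum_add_distrib, ← Finset.mul_sum, ← Finset.sum_mul, Finset.sum_const,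
    Finset.card_univ, nsmul_eq_mul, sum_latWeight h0 h1, one_mul] at hcmp
  rw [Finset.sum_comm (f := fun b k => ovl (latWeight d n δ b) (chanIn d n L) (fun _ => r)
      (chanIn d n (2 * n + 1) k)),
    Finset.sum_comm (f := fun b k => ovl (latWeight d n δ b) (chanIn d n (2 * n + 1))
      (fun _ => t) (chanIn d n (2 * n + 1) k))] at hcmp
  set SA := ∑ u, ∑ v, ∑ b, ovl (latWeight d n δ b) (chanIn d n L) (fun _ => r)
    (spinProd (n := n) u v) with hSA
  set SB := ∑ u, ∑ v, ∑ b, ovl (latWeight d n δ b) (chanIn d n (2 * n + 1)) (fun _ => t)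
    (spinProd (n := n) u v) with hSB
  have hSB0 : 0 ≤ SB := (Finset.sum_nonneg fun k _ => hB0 k).trans hBs
  -- The factor `L^d` in the number of pairs cancels the one in `r`, which makes the bound uniform
  -- in `L`. The constants come from `exp r - 1 ≤ 2 r` and `2L + 1 ≤ 3L`.
  have c1 : (Fintype.card (RangePair d n L) : ℝ) * (Real.exp r - 1) ≤ 2 * 3 ^ d * N * η := by
    have e1 := (abs_le.1 (Real.abs_exp_sub_one_le (x := r) (by rwa [abs_of_nonneg hr]))).2
    rw [abs_of_nonneg hr] at e1
    have e2 : (Fintype.card (RangePair d n L) : ℝ) ≤ N * (3 ^ d * (L : ℝ) ^ d) := by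
      have := card_rangePair_le d n L
      have h3 : (2 * L + 1) ^ d ≤ 3 ^ d * L ^ d := by
        rw [← mul_pow]; exact Nat.pow_le_pow_left (by omega) d
      have := this.trans (Nat.mul_le_mul_left _ h3)
      rw [hN_def]
      exact_mod_cast this
    calc _ ≤ N * (3 ^ d * (L : ℝ) ^ d) * (2 * r) := by
          refine mul_le_mul e2 e1 ?_ (by positivity)
          linarith [Real.add_one_le_exp r]
      _ = _ := by rw [hr_def]; field_simp
  have c2 : (Fintype.card (RangePair d n (2 * n + 1)) : ℝ) * (Real.cosh t - 1) ≤
      N ^ 2 * t ^ 2 := by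
    have e2 : (Fintype.card (RangePair d n (2 * n + 1)) : ℝ) ≤ N ^ 2 := by
      have := Fintype.card_le_of_injective _
        (RangePair.rep_injective (d := d) (n := n) (L := 2 * n + 1))
      rw [Fintype.card_prod, ← sq] at this
      rw [hN_def]
      exact_mod_cast this
    refine mul_le_mul e2 (cosh_sub_one_le_sq ht.le ht1) ?_ (by positivity)
    linarith [Real.one_le_cosh t]
  have c3 := mul_le_mul (sinh_le_two_mul ht.le ht1) hBs
    (Finset.sum_nonneg fun k _ => hB0 k) (by positivity)
  have c4 := mul_le_mul_of_nonneg_left hAs (show 0 ≤ t / 4 by positivity)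
  have fin : t / 4 * SA ≤ 2 * 3 ^ d * N * η + 2 * t * SB + N ^ 2 * t ^ 2 := by
    linarith
  have hl_eq : l = t * N := by rw [ht_def]; field_simp
  -- Multiplying `fin` by `4 / (t N²)` gives the three terms of the claim, since `t N = l`.
  have : 1 / N ^ 2 * SA = 4 / (t * N ^ 2) * (t / 4 * SA) := by field_simp
  rw [this, hl_eq]
  refine (mul_le_mul_of_nonneg_left fin (by positivity)).trans (le_of_eq ?_)
  field_simp
  ring

/-! ### The subcritical regime. -/

section Threshold

variable {δ : ℝ} (h0 : 0 < δ) (h1 : δ < 1)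
include h0 h1

theorem exists_tendsto_pairCorr {η : ℝ} (hη : η ∈ convSet d δ) :
    Tendsto (fun n => pairCorr d n δ η) atTop (𝓝 (qStar d δ η ^ 2)) := by
  obtain ⟨hpos, l, hl⟩ := hη
  have hl0 : 0 ≤ l := ge_of_tendsto' hl fun n => by
    rw [pairCorr_eq_meanOvl h0 h1 hpos.le]; exact meanOvl_nonneg h0 h1 _ _ _ _
  rwa [qStar, hl.limUnder_eq, Real.sq_sqrt hl0]

theorem qStar_mono {η η' : ℝ} (hη : η ∈ convSet d δ) (hη' : η' ∈ convSet d δ) (h : η ≤ η') :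
    qStar d δ η ≤ qStar d δ η' := by
  have := le_of_tendsto_of_tendsto' (exists_tendsto_pairCorr h0 h1 hη)
    (exists_tendsto_pairCorr h0 h1 hη') fun n => by
      rw [pairCorr_eq_meanOvl h0 h1 hη.1.le, pairCorr_eq_meanOvl h0 h1 hη'.1.le]
      exact meanOvl_mono h0 h1 _ _ _ hη.1.le h
  exact le_of_sq_le_sq this (Real.sqrt_nonneg _)

/-- Otherwise `qStar` is bounded below by `ε`; being monotone, it has its infimum as limit at `0⁺`,
so `q_⋆⋆(δ) > 0` and `deltaC d ≤ δ`. -/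
theorem exists_qStar_lt (hδ : δ < deltaC d) {ε : ℝ} (hε : 0 < ε) :
    ∃ l ∈ convSet d δ, qStar d δ l < ε := by
  by_contra! hcon
  have hno : ∀ q, IsQStarStar d δ q → ¬ 0 < q := fun q hq hq0 =>
    hδ.not_ge (csInf_le ⟨0, fun x hx => hx.1.le⟩ ⟨h0, h1.le, q, hq, hq0⟩)
  -- If `convSet d δ` were empty, the limit would be along `⊥` and every `q`, such as `1`, would be
  -- a limit. So no convergence result for `pairCorr` is needed.
  rcases (convSet d δ).eq_empty_or_nonempty with hE | hne
  · refine hno 1 ?_ one_pos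
    rw [IsQStarStar, hE, nhdsWithin_empty]
    exact tendsto_bot
  have hbdd : BddBelow (qStar d δ '' convSet d δ) :=
    ⟨ε, by rintro _ ⟨l, hl, rfl⟩; exact hcon l hl⟩
  refine hno (sInf (qStar d δ '' convSet d δ)) ?_ (hε.trans_le
    (le_csInf (hne.image _) (by rintro _ ⟨l, hl, rfl⟩; exact hcon l hl)))
  rw [IsQStarStar, Metric.tendsto_nhds]
  intro r hr
  obtain ⟨_, ⟨l, hl, rfl⟩, hlr⟩ := exists_lt_of_csInf_lt (hne.image (qStar d δ))
    (lt_add_of_pos_right _ hr)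
  filter_upwards [self_mem_nhdsWithin, mem_nhdsWithin_of_mem_nhds (Iio_mem_nhds hl.1)] with η hη hηl
  have e1 := csInf_le hbdd (Set.mem_image_of_mem _ hη)
  have e2 := qStar_mono h0 h1 hη hl (le_of_lt hηl)
  rw [Real.dist_eq, abs_of_nonneg (by linarith)]
  linarith

end Threshold

theorem tendsto_card_box {d : ℕ} (hd : 1 ≤ d) :
    Tendsto (fun n => (Fintype.card (Box d n) : ℝ)) atTop atTop := by
  refine tendsto_atTop_mono (fun n => ?_) (tendsto_natCast_atTop_atTop (R := ℝ))
  rw [card_box]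
  have : n ≤ (2 * n + 1) ^ d :=
    (show n ≤ 2 * n + 1 by omega).trans (Nat.le_self_pow (by omega) _)
  exact_mod_cast this

end

theorem mainTheorem2 (d : ℕ) (hd : 1 ≤ d) (δ : ℝ) (hδ_pos : 0 < δ) (hδ_lt_one : δ < 1)
    (hδ : δ < deltaC d) (L : ℕ → ℕ) (hL : ∀ n, 1 ≤ L n) :
    ∃ A : Set ℝ, A ⊆ Set.Ici 0 ∧ volume (Set.Ici (0 : ℝ) \ A) = 0 ∧
      ∀ T : ∀ (_ : ℝ) (n : ℕ), Box d n → Box d n → Obs d n (L n) → ℤˣ,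
        (∀ η n u v, Measurable (T η n u v)) →
        Tendsto (fun η => liminf (fun n => |risk d n (L n) δ η (T η n)|) atTop)
          (𝓝[A ∩ Set.Ioi 0] 0) (𝓝 0) := by
  refine ⟨Set.Ici 0, le_rfl, by simp, fun T hT => ?_⟩
  rw [Metric.tendsto_nhds]
  intro ε hε
  obtain ⟨l, hl, hlε⟩ := exists_qStar_lt hδ_pos hδ_lt_one hδ (show 0 < ε / 16 by positivity)
  have hl0 : 0 < l := hl.1
  have hq : qStar d δ l ^ 2 < (ε / 16) ^ 2 :=
    pow_lt_pow_left₀ hlε (Real.sqrt_nonneg _) two_ne_zero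
  have ev1 := (exists_tendsto_pairCorr hδ_pos hδ_lt_one hl).eventually_lt_const hq
  -- The summand `l` gives `l ≤ N`, as `meanOvl_le` requires; the other makes `4 l / N ≤ ε² / 16`.
  -- The bound on `η` below similarly makes `8 · 3^d η / l ≤ ε² / 16`.
  have ev2 := (tendsto_card_box hd).eventually_ge_atTop (l + 64 * l / ε ^ 2)
  have hη0 : 0 < min 1 (ε ^ 2 * l / (128 * 3 ^ d)) := lt_min one_pos (by positivity)
  filter_upwards [self_mem_nhdsWithin, mem_nhdsWithin_of_mem_nhds (Iio_mem_nhds hη0)]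
    with η hηA hη
  have hηp : 0 < η := hηA.2
  obtain ⟨hη1, hη2⟩ := lt_min_iff.1 (Set.mem_Iio.1 hη)
  -- With `α = ε` in `abs_risk_le` and `meanOvl ≤ ε² / 2`, the bound is `ε / 2 + ε / 4`. It holds
  -- for all large `n`, not merely along a subsequence.
  have bound : ∀ᶠ n in atTop, |risk d n (L n) δ η (T η n)| ≤ 3 / 4 * ε := by
    filter_upwards [ev1, ev2] with n hn1 hn2
    have hN : 0 < (Fintype.card (Box d n) : ℝ) := Nat.cast_pos.2 Fintype.card_pos
    have hpos : 0 ≤ 64 * l / ε ^ 2 := by positivity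
    have hM := meanOvl_le hδ_pos hδ_lt_one d n (hL n) hηp.le hη1.le hl0 (by linarith)
    have hR := abs_risk_le (L := L n) hδ_pos hδ_lt_one hηp.le hε (hT η n)
    have b1 : 8 * 3 ^ d * η / l ≤ ε ^ 2 / 16 := by
      rw [div_le_iff₀ hl0]
      rw [lt_div_iff₀ (by positivity)] at hη2
      linarith
    have b2 : 4 * l / Fintype.card (Box d n) ≤ ε ^ 2 / 16 := by
      have : 64 * l / ε ^ 2 ≤ Fintype.card (Box d n) := by linarith
      rw [div_le_iff₀ (by positivity)] at this
      rw [div_le_iff₀ hN]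
      linarith
    have b3 : meanOvl d n (L n) δ η ≤ ε ^ 2 / 2 := by nlinarith
    have b4 : (2 * ε)⁻¹ * meanOvl d n (L n) δ η ≤ ε / 4 :=
      (mul_le_mul_of_nonneg_left b3 (by positivity)).trans (le_of_eq (by field_simp; norm_num))
    linarith
  have hbd : IsBoundedUnder (· ≥ ·) atTop fun n => |risk d n (L n) δ η (T η n)| :=
    isBoundedUnder_of ⟨0, fun n => abs_nonneg _⟩
  have hup : liminf (fun n => |risk d n (L n) δ η (T η n)|) atTop ≤ 3 / 4 * ε :=
    liminf_le_of_frequently_le bound.frequently hbd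
  have hlow : 0 ≤ liminf (fun n => |risk d n (L n) δ η (T η n)|) atTop :=
    le_liminf_of_le (isCoboundedUnder_ge_of_eventually_le _ bound)
      (Eventually.of_forall fun n => abs_nonneg _)
  rw [Real.dist_eq, sub_zero, abs_of_nonneg hlow]
  linarith
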